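/- **Setting.** Values are drawn i.i.d. from a distribution $F$ on $[0,1]$. A (jointly measurable) bidding function $b(r,v)$, for $r,v\in[0,1]$, satisfies $b(r,v)\le v$; $b(r,v)\ge r$ if $v\ge r$; $b(r,v)=0$ if $v<r$; and $b(r,v)$ is non-decreasing in $v$. Assume *diminishing sensitivity*: for $h>0$ and $v_H>v_L\ge r+h$, $b(r+h,v_H)-b(r,v_H)\le b(r+h,v_L)-b(r,v_L)$. Let $\mu(r)=\mathbb E_{v\sim F}[b(r,v)]$ be the revenue, $D(r)=\Pr_{v\sim F}[v\ge r]$ the demand, and assume that $\mu$ is $L$-smooth on $[0,1]$ (differentiable with $L$-Lipschitz derivative). Let $F^{-1}(p)=\inf\{x\in[0,1]:F(x)\ge \min(p,1)\}$. **Algorithm.** Let $C$ be a closed convex set of reserves, $\Pi_C$ the projection onto $C$, $r_1\in C$, $q\in[0,1]$, $\epsilon_D\ge 0$, and let $\delta>0$ be such that $[r-\delta/2,\,r+\delta/2]\subseteq[0,1]$ for all $r\in C$. With a total of $N\ge1$ samples, put $T=\lfloor N^{2/3}\rfloor$ and $n=\lfloor N/T\rfloor$. In round $t=1,\dots,T$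 put $r_t^\pm=(1\pm\beta_t)r_t$ with $\beta_t=\delta/(2r_t)$, draw $n$ bids $X_i^+$ distributed as $b(r_t^+,v)$ and $n$ bids $X_i^-$ distributed as $b(r_t^-,v)$ from fresh independent values $v\sim F$, sort each sample in ascending order, and set $$\hat G_E=\frac{\sum_{i=1}^{\lfloor qn\rfloor}\max(X^+_{(i)}-r_t^+,0)-\sum_{i=1}^{\lfloor qn\rfloor}\max(X^-_{(i)}-r_t^-,0)}{n(r_t^+-r_t^-)}-(1-q),\qquad \hat G_D=\frac{r_t^+f(r_t^+)-r_t^-f(r_t^-)}{r_t^+-r_t^-},$$ where $f$ is a (measurable) demand function learned beforehand. Then $r_{t+1}=\Pi_C\big(r_t+\alpha_t(\hat G_E+\hat G_D)\big)$. Assume that $\hat G_D$ has bias at most $\epsilon_D/\delta$: for every current reserve $r_t\in C$, $$\Big|\hat G_D-\frac{r_t^+D(r_t^+)-r_t^-D(r_t^-)}{r_t^+-r_t^-}\Big|\le \frac{\epsilon_D}{\delta}.$$ **Claim.** Let $\mathcal P_C^t=\frac1{\alpha_t}\big(\Pi_C(r_t+\alpha_t\mu'(r_t))-r_t\big)$ be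 the gradient mapping. If $\delta=\Theta(\sqrt{\epsilon_D+1-q})$ and $\alpha_t=\Theta(1/\sqrt T)$, then $$\min_{t\in[T]}|\mathcal P_C^t|^2\le\tilde O\Big(\epsilon_D+1-q+\Big(1+\frac{F^{-1}(q+N^{-2/9})}{\epsilon_D+1-q}\Big)N^{-1/3}\Big)$$ with high probability. Precisely: there is a universal $k\in\mathbb N$ such that for all $L\ge0$ and $c_1,c_2,a_1,a_2>0$ there is $K>0$, depending only on these (not on $F$, $b$, $f$, $q$, $\epsilon_D$, $\delta$, $C$, $r_1$, $N$), such that, whenever the above holds with $c_1\sqrt{\epsilon_D+1-q}\le\delta\le c_2\sqrt{\epsilon_D+1-q}$ and $a_1/\sqrt T\le\alpha_t\le a_2/\sqrt T$ for all $t\in[T]$, for every $\eta\in(0,1)$, with probability at least $1-\eta$, $$\min_{t\in[T]}|\mathcal P_C^t|^2\le K\,\log(2N/\eta)^k\Big(\epsilon_D+1-q+\Big(1+\frac{F^{-1}(q+N^{-2/9})}{\epsilon_D+1-q}\Big)N^{-1/3}\Big).$$ -/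

import Mathlib

open MeasureTheory ProbabilityTheory Set
open scoped NNReal

noncomputable section

namespace ReserveOpt

/-- A bidding function `b r v` (reserve `r`, value `v`, both in `[0,1]`). -/
structure IsBiddingFunction (b : ℝ → ℝ → ℝ) : Prop where
  le_value : ∀ r ∈ Icc (0 : ℝ) 1, ∀ v ∈ Icc (0 : ℝ) 1, b r v ≤ v
  reserve_le : ∀ r ∈ Icc (0 : ℝ) 1, ∀ v ∈ Icc (0 : ℝ) 1, r ≤ v → r ≤ b r v
  eq_zero : ∀ r ∈ Icc (0 : ℝ) 1, ∀ v ∈ Icc (0 : ℝ) 1, v < r → b r v = 0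
  mono : ∀ r ∈ Icc (0 : ℝ) 1, MonotoneOn (b r) (Icc 0 1)

/-- Diminishing sensitivity of the bid to the reserve. -/
def DiminishingSensitivity (b : ℝ → ℝ → ℝ) : Prop :=
  ∀ r ∈ Icc (0 : ℝ) 1, ∀ h > 0, ∀ vL ∈ Icc (0 : ℝ) 1, ∀ vH ∈ Icc (0 : ℝ) 1,
    vL < vH → r + h ≤ vL → b (r + h) vH - b r vH ≤ b (r + h) vL - b r vL

/-- Expected revenue `μ(r) = E_{v ∼ F}[b(r, v)]`. -/
def revenue (F : Measure ℝ) (b : ℝ → ℝ → ℝ) (r : ℝ) : ℝ := ∫ v, b r v ∂F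

/-- The demand curve `D(r) = Pr_{v ∼ F}[v ≥ r]`. -/
def demand (F : Measure ℝ) (r : ℝ) : ℝ := F.real (Ici r)

/-- The inverse distribution function of a distribution on `[0,1]`,
`F⁻¹(p) = inf {x ∈ [0,1] : F(x) ≥ p}` for `p ≤ 1`; a level above `1` is read as `1`. -/
def quantile (F : Measure ℝ) (p : ℝ) : ℝ :=
  sInf {x : ℝ | x ∈ Icc (0 : ℝ) 1 ∧ min p 1 ≤ cdf F x}

/-- `f` is differentiable on `[0,1]` with an `L`-Lipschitz derivative. -/
def IsSmoothOnUnit (L : ℝ≥0) (f : ℝ → ℝ) : Prop :=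
  DifferentiableOn ℝ f (Icc 0 1) ∧ LipschitzOnWith L (derivWithin f (Icc 0 1)) (Icc 0 1)

open Classical in
/-- Projection onto `C`: a point of `C` nearest to `x` (it exists if `C` is closed and nonempty,
and is unique if `C` is moreover convex). -/
def proj (C : Set ℝ) (x : ℝ) : ℝ :=
  if h : ∃ z ∈ C, ∀ w ∈ C, |z - x| ≤ |w - x| then h.choose else x

theorem proj_spec {C : Set ℝ} (hC : IsClosed C) (hne : C.Nonempty) (x : ℝ) :
    proj C x ∈ C ∧ ∀ w ∈ C, |proj C x - x| ≤ |w - x| := by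
  have h : ∃ z ∈ C, ∀ w ∈ C, |z - x| ≤ |w - x| := by
    obtain ⟨z, hz, hd⟩ := hC.exists_infDist_eq_dist hne x
    refine ⟨z, hz, fun w hw => ?_⟩
    have h1 := Metric.infDist_le_dist_of_mem (x := x) hw
    rw [hd, dist_comm, dist_comm x w, Real.dist_eq, Real.dist_eq] at h1
    exact h1
  unfold proj
  rw [dif_pos h]
  exact h.choose_spec

/-- The gradient mapping `P_C(r, g, α) = (Π_C(r + α g) - r) / α`. -/
def gradMap (C : Set ℝ) (r g α : ℝ) : ℝ := 1 / α * (proj C (r + α * g) - r)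

/-- `∑_{i ≤ qn} max(X_(i) - r, 0)` where `X_(1) ≤ ⋯ ≤ X_(n)` are the sorted bids
(`qn` rounded down). -/
def truncSum (q r : ℝ) {n : ℕ} (X : Fin n → ℝ) : ℝ :=
  ∑ i ∈ Finset.univ.filter (fun i : Fin n => (i : ℕ) < ⌊q * n⌋₊), max (X (Tuple.sort X i) - r) 0

/-- Quantile-truncation estimator of the discrete gradient of the bidding component, from the
bids `Xp` at reserve `rp` and the bids `Xm` at reserve `rm`. -/
def bidGradEst (q rp rm : ℝ) {n : ℕ} (Xp Xm : Fin n → ℝ) : ℝ :=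
  (truncSum q rp Xp - truncSum q rm Xm) / (n * (rp - rm)) - (1 - q)

/-- Estimate of the discrete gradient of the demand component `r D(r)` given by a (learned)
demand function `f`. The true discrete gradient is the same expression with `f` replaced by the
true demand. -/
def demandGrad (f : ℝ → ℝ) (rp rm : ℝ) : ℝ := (rp * f rp - rm * f rm) / (rp - rm)

/-- The perturbation size `β = δ / (2 r)`. -/
def perturb (δ r : ℝ) : ℝ := δ / (2 * r)

/-- The upper and lower test reserves `(1 + β) r` and `(1 - β) r`. -/
def resUp (δ r : ℝ) : ℝ := (1 + perturb δ r) * r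

def resDown (δ r : ℝ) : ℝ := (1 - perturb δ r) * r

/-- Bias of the demand-gradient estimate at the current reserve `r`. Given the learned `f`, the
estimate is not random, so it is its own expectation. -/
def demandBias (F : Measure ℝ) (f : ℝ → ℝ) (δ r : ℝ) : ℝ :=
  |demandGrad f (resUp δ r) (resDown δ r) - demandGrad (demand F) (resUp δ r) (resDown δ r)|

/-- The reserves of projected gradient ascent with `n` auctions at each of the two test reserves
per round. `v (t, true, i)` and `v (t, false, i)` are the values in the `i`-th auction of round `t`
at the upper and at the lower test reserve. Rounds are counted from `0`: `reserve … t` is the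
reserve in the `(t+1)`-st round, and `reserve … 0 = r₁` is the initial one. -/
def reserve (b : ℝ → ℝ → ℝ) (f : ℝ → ℝ) (q δ : ℝ) (n : ℕ) (C : Set ℝ) (α : ℕ → ℝ) (r₁ : ℝ)
    (v : ℕ × Bool × ℕ → ℝ) : ℕ → ℝ
  | 0 => r₁
  | t + 1 =>
    let r := reserve b f q δ n C α r₁ v t
    let rp := resUp δ r
    let rm := resDown δ r
    let G := bidGradEst q rp rm (fun i : Fin n => b rp (v (t, true, i)))
        (fun i : Fin n => b rm (v (t, false, i))) + demandGrad f rp rm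
    proj C (r + α t * G)

/-- The number of rounds, `T = N^{2/3}` (rounded down). -/
def numRounds (N : ℕ) : ℕ := ⌊(N : ℝ) ^ (2 / 3 : ℝ)⌋₊

/-- The number of samples per round, `N / T` (rounded down). -/
def samplesPerRound (N : ℕ) : ℕ := N / numRounds N

end ReserveOpt

end

open ReserveOpt

/-!
# Projected gradient ascent for reserve prices

The rate follows from a deterministic analysis of projected gradient ascent once every gradient
estimate is accurate, and accuracy holds in all rounds at once on an event that depends only on the
sampled values, not on the reserves chosen by the algorithm. No conditioning on the past is needed.

*Ascent.* If every estimate is within `E` of the derivative of the revenue, then each step gains at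
least a multiple of `α_t (|P_t|² - O(E²))` (`ascent_step`). The revenue lies in `[0, 1]`, so that
some round satisfies `|P_t|² ≤ O(1 / √T) + O(E²)` (`exists_gradMap_sq_le`).

*Bias.* Write `κ = ε_D + 1 - q`. The revenue is the mean excess of the bid over the reserve plus
`r D(r)` (`revenue_eq`). Discarding the values above the `q`-quantile changes the mean excess by at
most `1 - q`, hence the gradient by at most `(1 - q) / δ = O(√κ)`. The demand bias `ε_D / δ` and the
discretization error `L δ` are of the same order (`abs_gradEst_sub_le`, `sq_error_le`).

*Sampling error.* For a fixed reserve the excess, capped at `s`, is a monotone function of the value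
with range `[0, s]`. Its sample mean therefore differs from its expectation by at most `s` times the
largest discrepancy between the empirical and the true measure of a lower set
(`abs_integral_sub_le_of_lowerSet`). This discrepancy is `O(√(log(2N/η) / n))` simultaneously for
all lower sets, by Hoeffding's inequality on a grid of quantiles
(`abs_real_sub_le_of_quantile_rays`, `prob_not_typical_le`). If at most `(1 - q) n` values exceed
`s`, the sum over the lowest `⌊q n⌋` bids agrees with the capped sum up to `s ((1 - q) n + 1)`
(`abs_truncSum_sub_sum_min_le`). So `E² = Õ(κ + s² N^{-1/3} / κ)`.

*The cap.* If `κ ≥ N^{-1/6}`, the choice `s = 1` suffices, since then `N^{-1/3} / κ ≤ κ`. Otherwise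
`1 - q < N^{-1/6}`, the number of values above a high quantile has small variance, and a Chernoff
bound shows that `s = F⁻¹(q + N^{-2/9})` is exceeded at most `(1 - q) n` times
(`prob_lt_sum_indicator_quantile_le`, `exists_cap`). The Chernoff bound is too weak only if
`log(2N/η)` exceeds a multiple of `N^{1/18}`. Its sixth power then compensates the factor
`N^{-1/3}`, and the bound on the derivative of the revenue is enough. This case determines the power
of the logarithm.
-/

namespace ReserveOpt

open scoped ENNReal Topology
open Filter

/-! ### Projections and gradient mappings on the line -/

theorem proj_eq_self {C : Set ℝ} (hC : IsClosed C) {r : ℝ} (hr : r ∈ C) : proj C r = r := by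
  have h := (proj_spec hC ⟨r, hr⟩ r).2 r hr
  rw [sub_self, abs_zero] at h
  linarith [abs_eq_zero.1 (le_antisymm h (abs_nonneg _))]

/-- The variational inequality characterizing the nearest point of a convex set. -/
theorem proj_variational {C : Set ℝ} (hC : IsClosed C) (hconv : Convex ℝ C) (x : ℝ) {w : ℝ}
    (hw : w ∈ C) : (x - proj C x) * (w - proj C x) ≤ 0 := by
  obtain ⟨hp, hmin⟩ := proj_spec hC ⟨w, hw⟩ x
  set p := proj C x
  by_contra! hc
  have hd : 0 < (w - p) ^ 2 := by
    have : w - p ≠ 0 := fun h => by rw [h, mul_zero] at hc; exact lt_irrefl _ hc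
    positivity
  -- moving from `p` towards `w` by this fraction would decrease the distance to `x`
  set l := min 1 ((x - p) * (w - p) / (w - p) ^ 2)
  have hl0 : 0 < l := lt_min one_pos (div_pos hc hd)
  have hl1 : l ≤ 1 := min_le_left _ _
  have hl2 : l * (w - p) ^ 2 ≤ (x - p) * (w - p) := (le_div_iff₀ hd).1 (min_le_right _ _)
  have hmem : (1 - l) • p + l • w ∈ C := hconv hp hw (by linarith) hl0.le (by ring)
  have h := sq_le_sq.2 (hmin _ hmem)
  simp only [smul_eq_mul] at h
  nlinarith [mul_pos hl0 hc, mul_le_mul_of_nonneg_left hl2 hl0.le]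

theorem abs_proj_sub_proj_le {C : Set ℝ} (hC : IsClosed C) (hconv : Convex ℝ C)
    (hne : C.Nonempty) (x y : ℝ) : |proj C x - proj C y| ≤ |x - y| := by
  have h1 := proj_variational hC hconv x (proj_spec hC hne y).1
  have h2 := proj_variational hC hconv y (proj_spec hC hne x).1
  set p := proj C x
  set p' := proj C y
  have h3 : |p - p'| * |p - p'| ≤ |p - p'| * |x - y| := by
    rw [← abs_mul, ← abs_mul, abs_of_nonneg (mul_self_nonneg _)]
    exact le_trans (by linarith) (le_abs_self _)
  rcases (abs_nonneg (p - p')).eq_or_lt with h | h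
  · rw [← h]; exact abs_nonneg _
  · exact le_of_mul_le_mul_left h3 h

theorem abs_gradMap_sub_le {C : Set ℝ} (hC : IsClosed C) (hconv : Convex ℝ C) {r α : ℝ}
    (hr : r ∈ C) (hα : 0 < α) (g g' : ℝ) :
    |gradMap C r g α - gradMap C r g' α| ≤ |g - g'| := by
  have h := abs_proj_sub_proj_le hC hconv ⟨r, hr⟩ (r + α * g) (r + α * g')
  have e1 : gradMap C r g α - gradMap C r g' α
      = (proj C (r + α * g) - proj C (r + α * g')) / α := by
    unfold gradMap; field_simp; ring
  rw [e1, abs_div, abs_of_pos hα, div_le_iff₀ hα]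
  refine h.trans_eq ?_
  rw [show r + α * g - (r + α * g') = (g - g') * α by ring, abs_mul, abs_of_pos hα]

theorem abs_gradMap_le {C : Set ℝ} (hC : IsClosed C) (hconv : Convex ℝ C) {r α : ℝ}
    (hr : r ∈ C) (hα : 0 < α) (g : ℝ) : |gradMap C r g α| ≤ |g| := by
  have h := abs_gradMap_sub_le hC hconv hr hα g 0
  simpa [gradMap, proj_eq_self hC hr] using h

/-- One step of projected gradient ascent with an inexact gradient `G` of a function with quadratic
lower bound `hsm` along the step: the gain controls the squared gradient mapping. -/
theorem ascent_step {C : Set ℝ} (hC : IsClosed C) (hconv : Convex ℝ C) {r α L g G E m m' : ℝ}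
    (hr : r ∈ C) (hα : 0 < α) (hαL : L * α ≤ 1 / 4) (he : |G - g| ≤ E)
    (hsm : m + g * (proj C (r + α * G) - r) - L * (proj C (r + α * G) - r) ^ 2 ≤ m') :
    α * (|gradMap C r g α| ^ 2 / 8 - 3 / 4 * E ^ 2) ≤ m' - m := by
  have hd := abs_gradMap_sub_le hC hconv hr hα g G
  have hv := proj_variational hC hconv (r + α * G) hr
  set p := gradMap C r G α with hp
  have hpr : proj C (r + α * G) - r = α * p := by rw [hp, gradMap]; field_simp
  have hpr' : proj C (r + α * G) = r + α * p := by linarith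
  rw [hpr] at hsm
  rw [hpr'] at hv
  set P := gradMap C r g α
  have hE : 0 ≤ E := (abs_nonneg _).trans he
  have he2 : (G - g) ^ 2 ≤ E ^ 2 := sq_le_sq' (abs_le.1 he).1 (abs_le.1 he).2
  have hd2 : (P - p) ^ 2 ≤ E ^ 2 := by
    rw [abs_sub_comm g G] at hd
    have := hd.trans he
    exact sq_le_sq' (abs_le.1 this).1 (abs_le.1 this).2
  have hGp : p ^ 2 ≤ G * p := by
    have : α ^ 2 * (p ^ 2 - G * p) ≤ 0 := by nlinarith
    nlinarith [pow_pos hα 2]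
  have hgp : p ^ 2 / 2 - E ^ 2 / 2 ≤ g * p := by nlinarith [sq_nonneg (p - (G - g))]
  rw [sq_abs]
  have hP : P ^ 2 ≤ 2 * p ^ 2 + 2 * E ^ 2 := by nlinarith [sq_nonneg (P - 2 * p)]
  have hL : L * (α * p) ^ 2 ≤ α * (p ^ 2 / 4) := by
    have := mul_le_mul_of_nonneg_right hαL (mul_nonneg hα.le (sq_nonneg p))
    nlinarith
  have h1 : α * (P ^ 2 / 8 - 3 / 4 * E ^ 2) ≤ α * (p ^ 2 / 4 - E ^ 2 / 2) :=
    mul_le_mul_of_nonneg_left (by linarith) hα.le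
  have h2 : α * (p ^ 2 / 2 - E ^ 2 / 2) ≤ α * (g * p) := mul_le_mul_of_nonneg_left hgp hα.le
  nlinarith

/-- Projected gradient ascent with gradients of accuracy `E`, on an objective with values in
`[0, 1]`, visits a point with small gradient mapping. -/
theorem exists_gradMap_sq_le {C : Set ℝ} (hC : IsClosed C) (hconv : Convex ℝ C)
    {μ g : ℝ → ℝ} {L E a : ℝ} {T : ℕ} (hT : 0 < T) (ha : 0 < a) {r G α : ℕ → ℝ} (hr0 : r 0 ∈ C)
    (hstep : ∀ t, r (t + 1) = proj C (r t + α t * G t))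
    (hμ : ∀ x ∈ C, μ x ∈ Icc (0 : ℝ) 1)
    (hsm : ∀ x ∈ C, ∀ y ∈ C, μ x + g x * (y - x) - L * (y - x) ^ 2 ≤ μ y)
    (hα : ∀ t < T, a ≤ α t) (hαL : ∀ t < T, L * α t ≤ 1 / 4)
    (he : ∀ t < T, |G t - g (r t)| ≤ E) :
    ∃ t < T, |gradMap C (r t) (g (r t)) (α t)| ^ 2 ≤ 8 / (T * a) + 6 * E ^ 2 := by
  have hmem : ∀ t, r t ∈ C := by
    intro t
    cases t with
    | zero => exact hr0
    | succ t => rw [hstep]; exact (proj_spec hC ⟨_, hr0⟩ _).1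
  by_contra! hcon
  have hTa : (0 : ℝ) < T * a := by positivity
  have hgain : ∀ t ∈ Finset.range T, 1 / (T : ℝ) < μ (r (t + 1)) - μ (r t) := by
    intro t ht
    have ht := Finset.mem_range.1 ht
    have hαt : 0 < α t := ha.trans_le (hα t ht)
    have h1 := ascent_step hC hconv (hmem t) hαt (hαL t ht) (he t ht)
      (m := μ (r t)) (m' := μ (r (t + 1)))
      (by have := hsm _ (hmem t) _ (hmem (t + 1)); rwa [hstep] at this ⊢)
    have h2 := hcon t ht
    have h3 : 1 / (T * a) < |gradMap C (r t) (g (r t)) (α t)| ^ 2 / 8 - 3 / 4 * E ^ 2 := by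
      have : 8 / (T * a) = 8 * (1 / (T * a)) := by ring
      linarith
    have h4 : 1 / (T : ℝ) ≤ α t * (1 / (T * a)) := by
      have : (1 : ℝ) / T = a * (1 / (T * a)) := by field_simp
      rw [this]
      exact mul_le_mul_of_nonneg_right (hα t ht) (by positivity)
    exact h4.trans_lt ((mul_lt_mul_of_pos_left h3 hαt).trans_le h1)
  have hsum := Finset.sum_lt_sum_of_nonempty (Finset.nonempty_range_iff.2 hT.ne') hgain
  rw [Finset.sum_range_sub (fun t => μ (r t))] at hsum
  have h1 : ∑ _t ∈ Finset.range T, 1 / (T : ℝ) = 1 := by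
    simp only [Finset.sum_const, Finset.card_range, nsmul_eq_mul]
    field_simp
  rw [h1] at hsum
  linarith [(hμ _ (hmem T)).2, (hμ _ (hmem 0)).1]

/-! ### Smooth functions on the unit interval -/

/-- First-order Taylor estimate. The constant `L` instead of `L / 2` comes from the mean value
inequality and is enough here. -/
theorem IsSmoothOnUnit.abs_taylor_le {L : ℝ≥0} {f : ℝ → ℝ} (hf : IsSmoothOnUnit L f) {x y : ℝ}
    (hx : x ∈ Icc (0 : ℝ) 1) (hy : y ∈ Icc (0 : ℝ) 1) :
    |f y - f x - derivWithin f (Icc 0 1) x * (y - x)| ≤ L * (y - x) ^ 2 := by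
  set d := derivWithin f (Icc 0 1)
  have hsub : uIcc x y ⊆ Icc 0 1 := (convex_Icc (0 : ℝ) 1).ordConnected.uIcc_subset hx hy
  have hder : ∀ z ∈ uIcc x y,
      HasDerivWithinAt (fun z => f z - d x * z) (d z - d x) (uIcc x y) z := by
    intro z hz
    have h1 : HasDerivWithinAt f (d z) (Icc 0 1) z := (hf.1 z (hsub hz)).hasDerivWithinAt
    have h2 := ((hasDerivAt_id z).const_mul (d x)).hasDerivWithinAt (s := uIcc x y)
    rw [mul_one] at h2
    exact (h1.mono hsub).sub h2
  have hbd : ∀ z ∈ uIcc x y, ‖d z - d x‖ ≤ L * |y - x| := by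
    intro z hz
    have h1 := hf.2.dist_le_mul z (hsub hz) x hx
    rw [Real.dist_eq, Real.dist_eq] at h1
    refine h1.trans (mul_le_mul_of_nonneg_left ?_ L.2)
    exact abs_sub_left_of_mem_uIcc hz
  have h := (convex_uIcc x y).norm_image_sub_le_of_norm_hasDerivWithin_le hder hbd
    left_mem_uIcc right_mem_uIcc
  simp only [Real.norm_eq_abs] at h
  rw [mul_assoc, abs_mul_abs_self] at h
  rw [sq]
  refine le_trans (le_of_eq ?_) h
  congr 1; ring

theorem IsSmoothOnUnit.abs_derivWithin_le {L : ℝ≥0} {f : ℝ → ℝ} (hf : IsSmoothOnUnit L f)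
    (hf01 : ∀ x ∈ Icc (0 : ℝ) 1, f x ∈ Icc (0 : ℝ) 1) {x : ℝ} (hx : x ∈ Icc (0 : ℝ) 1) :
    |derivWithin f (Icc 0 1) x| ≤ 2 * (1 + L) := by
  -- compare with the endpoint of `[0, 1]` that is at distance at least `1 / 2`
  obtain ⟨y, hy, hyx⟩ : ∃ y ∈ Icc (0 : ℝ) 1, 1 / 2 ≤ |y - x| ∧ |y - x| ≤ 1 := by
    rcases le_total x (1 / 2) with h | h
    · refine ⟨1, by simp, ?_⟩
      rw [abs_of_nonneg (by linarith [hx.2])]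
      constructor <;> linarith [hx.1]
    · refine ⟨0, by simp, ?_⟩
      rw [abs_of_nonpos (by linarith [hx.1])]
      constructor <;> linarith [hx.2]
  have h := hf.abs_taylor_le hx hy
  set d := derivWithin f (Icc 0 1) x
  have h1 : |d * (y - x)| ≤ 1 + L := by
    have e : d * (y - x) = (f y - f x) - (f y - f x - d * (y - x)) := by ring
    rw [e]
    refine (abs_sub _ _).trans (add_le_add ?_ (h.trans ?_))
    · rw [abs_le]
      constructor <;> linarith [(hf01 x hx).1, (hf01 x hx).2, (hf01 y hy).1, (hf01 y hy).2]
    · have : (y - x) ^ 2 ≤ 1 := by rw [← sq_abs]; nlinarith [abs_nonneg (y - x)]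
      nlinarith [L.2]
  rw [abs_mul] at h1
  nlinarith [abs_nonneg d]

theorem IsSmoothOnUnit.abs_symmDiffQuot_sub_le {L : ℝ≥0} {f : ℝ → ℝ} (hf : IsSmoothOnUnit L f)
    {x δ : ℝ} (hδ : 0 < δ) (h0 : 0 ≤ x - δ / 2) (h1 : x + δ / 2 ≤ 1) :
    |(f (x + δ / 2) - f (x - δ / 2)) / δ - derivWithin f (Icc 0 1) x| ≤ L * δ := by
  have hx : x ∈ Icc (0 : ℝ) 1 := ⟨by linarith, by linarith⟩
  have hp := hf.abs_taylor_le hx (y := x + δ / 2) ⟨by linarith, h1⟩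
  have hm := hf.abs_taylor_le hx (y := x - δ / 2) ⟨h0, by linarith⟩
  set d := derivWithin f (Icc 0 1) x
  have e : (f (x + δ / 2) - f (x - δ / 2)) / δ - d
      = ((f (x + δ / 2) - f x - d * (x + δ / 2 - x))
        - (f (x - δ / 2) - f x - d * (x - δ / 2 - x))) / δ := by
    field_simp; ring
  rw [e, abs_div, abs_of_pos hδ, div_le_iff₀ hδ]
  refine (abs_sub _ _).trans ?_
  have : (L : ℝ) * (δ * δ) ≥ 0 := mul_nonneg L.2 (by positivity)
  nlinarith

/-! ### The revenue and its bidding component -/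

theorem IsBiddingFunction.mem_Icc {b : ℝ → ℝ → ℝ} (hb : IsBiddingFunction b) {r v : ℝ}
    (hr : r ∈ Icc (0 : ℝ) 1) (hv : v ∈ Icc (0 : ℝ) 1) : b r v ∈ Icc (0 : ℝ) 1 := by
  refine ⟨?_, (hb.le_value r hr v hv).trans hv.2⟩
  rcases le_or_gt r v with h | h
  · exact hr.1.trans (hb.reserve_le r hr v hv h)
  · exact (hb.eq_zero r hr v hv h).ge

theorem ae_mem_unit {F : Measure ℝ} [IsProbabilityMeasure F] (hF : F (Icc (0 : ℝ) 1) = 1) :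
    ∀ᵐ v ∂F, v ∈ Icc (0 : ℝ) 1 :=
  (mem_ae_iff_prob_eq_one measurableSet_Icc).2 hF

theorem revenue_mem_Icc {F : Measure ℝ} [IsProbabilityMeasure F] (hF : F (Icc (0 : ℝ) 1) = 1)
    {b : ℝ → ℝ → ℝ} (hb : IsBiddingFunction b) {r : ℝ} (hr : r ∈ Icc (0 : ℝ) 1) :
    revenue F b r ∈ Icc (0 : ℝ) 1 := by
  have h := ae_mem_unit hF
  constructor
  · exact integral_nonneg_of_ae (h.mono fun v hv => (hb.mem_Icc hr hv).1)
  · calc revenue F b r ≤ ∫ _v, (1 : ℝ) ∂F := by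
          refine integral_mono_of_nonneg (h.mono fun v hv => (hb.mem_Icc hr hv).1)
            (integrable_const _) (h.mono fun v hv => (hb.mem_Icc hr hv).2)
      _ = 1 := by simp

/-- A bid is the reserve, when it is met, plus the excess of the bid over the reserve. -/
theorem revenue_eq {F : Measure ℝ} [IsProbabilityMeasure F] (hF : F (Icc (0 : ℝ) 1) = 1)
    {b : ℝ → ℝ → ℝ} (hbm : Measurable (Function.uncurry b)) (hb : IsBiddingFunction b) {r : ℝ}
    (hr : r ∈ Icc (0 : ℝ) 1) :
    revenue F b r = ∫ v, max (b r v - r) 0 ∂F + r * demand F r := by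
  have h := ae_mem_unit hF
  have hbr : Measurable (b r) := hbm.comp measurable_prodMk_left
  have hint : Integrable (fun v => max (b r v - r) 0) F := by
    refine Integrable.of_mem_Icc 0 1 (by fun_prop) (h.mono fun v hv => ⟨le_max_right _ _, ?_⟩)
    exact max_le (by linarith [(hb.mem_Icc hr hv).2, hr.1]) zero_le_one
  have hind : Integrable ((Ici r).indicator fun _ => r) F :=
    (integrable_const r).indicator measurableSet_Ici
  have e : r * demand F r = ∫ v, (Ici r).indicator (fun _ => r) v ∂F := by
    rw [integral_indicator_const _ measurableSet_Ici, demand, smul_eq_mul, mul_comm]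
  rw [e, ← integral_add hint hind]
  refine integral_congr_ae (h.mono fun v hv => ?_)
  rcases le_or_gt r v with hrv | hrv
  · have := hb.reserve_le r hr v hv hrv
    simp [indicator, hrv, this]
  · have := hb.eq_zero r hr v hv hrv
    simp [indicator, not_le.2 hrv, this, hr.1]

/-! ### Quantiles -/

section Quantile

variable {F : Measure ℝ} [IsProbabilityMeasure F]

theorem cdf_one (hF : F (Icc (0 : ℝ) 1) = 1) : cdf F 1 = 1 := by
  rw [cdf_eq_real]
  refine le_antisymm measureReal_le_one ?_
  have h : F.real (Icc (0 : ℝ) 1) = 1 := by simp [Measure.real, hF]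
  exact h.ge.trans (measureReal_mono Icc_subset_Iic_self)

theorem quantile_mem_Icc (hF : F (Icc (0 : ℝ) 1) = 1) (p : ℝ) : quantile F p ∈ Icc (0 : ℝ) 1 := by
  have hmem : (1 : ℝ) ∈ {x : ℝ | x ∈ Icc (0 : ℝ) 1 ∧ min p 1 ≤ cdf F x} := by
    refine ⟨by simp, ?_⟩
    rw [cdf_one hF]
    exact min_le_right _ _
  exact ⟨le_csInf ⟨1, hmem⟩ fun x hx => hx.1.1, csInf_le ⟨0, fun x hx => hx.1.1⟩ hmem⟩

theorem le_real_Iic_quantile (hF : F (Icc (0 : ℝ) 1) = 1) (p : ℝ) :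
    min p 1 ≤ F.real (Iic (quantile F p)) := by
  rw [← cdf_eq_real]
  have hne : {x : ℝ | x ∈ Icc (0 : ℝ) 1 ∧ min p 1 ≤ cdf F x}.Nonempty := by
    refine ⟨1, by simp, ?_⟩
    rw [cdf_one hF]
    exact min_le_right _ _
  have hcont : Tendsto (cdf F) (𝓝[>] quantile F p) (𝓝 (cdf F (quantile F p))) :=
    ((cdf F).right_continuous _).tendsto.mono_left (nhdsWithin_mono _ Ioi_subset_Ici_self)
  refine ge_of_tendsto hcont (eventually_nhdsWithin_of_forall fun y hy => ?_)
  obtain ⟨x, hx, hxy⟩ := exists_lt_of_csInf_lt hne hy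
  exact hx.2.trans (monotone_cdf F hxy.le)

theorem real_Iio_quantile_le (hF : F (Icc (0 : ℝ) 1) = 1) {p : ℝ} (hp : 0 ≤ p) :
    F.real (Iio (quantile F p)) ≤ p := by
  have hle : ∀ y < quantile F p, cdf F y ≤ p := by
    intro y hy
    rcases lt_or_ge y 0 with h0 | h0
    · refine le_trans (le_of_eq ?_) hp
      have hnull : F (Icc (0 : ℝ) 1)ᶜ = 0 := (prob_compl_eq_zero_iff measurableSet_Icc).2 hF
      have hsub : Iic y ⊆ (Icc (0 : ℝ) 1)ᶜ := fun z hz hz' => by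
        have := hz'.1; have := mem_Iic.1 hz; linarith
      rw [cdf_eq_real, Measure.real, measure_mono_null hsub hnull, ENNReal.toReal_zero]
    · by_contra! hlt
      refine notMem_of_lt_csInf hy ⟨0, fun x hx => hx.1.1⟩ ⟨⟨h0, ?_⟩, ?_⟩
      · exact hy.le.trans (quantile_mem_Icc hF p).2
      · exact (min_le_left _ _).trans hlt.le
  have hlim : Function.leftLim (cdf F) (quantile F p) ≤ p :=
    le_of_tendsto ((monotone_cdf F).tendsto_leftLim _)
      (eventually_nhdsWithin_of_forall fun y hy => hle y hy)
  have h := (cdf F).measure_Iio (tendsto_cdf_atBot F) (quantile F p)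
  rw [measure_cdf, sub_zero] at h
  rw [Measure.real, h]
  exact ENNReal.toReal_le_of_le_ofReal hp (ENNReal.ofReal_le_ofReal hlim)

/-- Closeness on the quantile rays of levels `j / m` implies closeness on all lower sets: a lower
set lies between two rays whose masses differ by at most `1 / m`. -/
theorem abs_real_sub_le_of_quantile_rays (hF : F (Icc (0 : ℝ) 1) = 1) {ν : Measure ℝ}
    [IsProbabilityMeasure ν] {m : ℕ} (hm : 0 < m) {ε : ℝ} (hε : 0 ≤ ε)
    (hc : ∀ j < m, |ν.real (Iic (quantile F (j / m))) - F.real (Iic (quantile F (j / m)))| ≤ ε)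
    (ho : ∀ j < m, |ν.real (Iio (quantile F (j / m))) - F.real (Iio (quantile F (j / m)))| ≤ ε)
    {I : Set ℝ} (hI : IsLowerSet I) : |ν.real I - F.real I| ≤ ε + 1 / m := by
  classical
  have hm' : (0 : ℝ) < m := by exact_mod_cast hm
  have hex : ∃ k, k = m ∨ quantile F (k / m) ∉ I := ⟨m, Or.inl rfl⟩
  -- the first grid point outside `I`
  obtain ⟨k, hk, hmin⟩ : ∃ k, (k = m ∨ quantile F (k / m) ∉ I) ∧
      ∀ j < k, ¬ (j = m ∨ quantile F (j / m) ∉ I) :=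
    ⟨Nat.find hex, Nat.find_spec hex, fun j hj => Nat.find_min hex hj⟩
  have hkm : k ≤ m := by
    by_contra! h
    exact hmin m h (Or.inl rfl)
  have hup : F.real I ≤ k / m ∧ ν.real I ≤ k / m + ε := by
    rcases hkm.eq_or_lt with rfl | hlt
    · rw [div_self hm'.ne']
      exact ⟨measureReal_le_one, measureReal_le_one.trans (by linarith)⟩
    · have hnot : quantile F (k / m) ∉ I := hk.resolve_left hlt.ne
      have hsub : I ⊆ Iio (quantile F (k / m)) := fun x hx => by
        by_contra h
        exact hnot (hI (not_lt.1 h) hx)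
      have h1 := real_Iio_quantile_le hF (p := (k : ℝ) / m) (by positivity)
      have h2 := measureReal_mono (μ := F) hsub
      have h3 := measureReal_mono (μ := ν) hsub
      have h4 := (abs_le.1 (ho k hlt)).2
      exact ⟨h2.trans h1, by linarith⟩
  have hlow : (k : ℝ) / m - 1 / m ≤ F.real I ∧ (k : ℝ) / m - 1 / m - ε ≤ ν.real I := by
    rcases k with _ | k
    · have : 0 < 1 / (m : ℝ) := by positivity
      simp only [Nat.cast_zero, zero_div]
      constructor
      · exact le_trans (by linarith) measureReal_nonneg
      · exact le_trans (by linarith) measureReal_nonneg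
    · have hmemI : quantile F (k / m) ∈ I := by
        have := hmin k (Nat.lt_succ_self k)
        push Not at this
        exact this.2
      have hsub : Iic (quantile F (k / m)) ⊆ I := fun x hx => hI hx hmemI
      have hk1 : (k : ℝ) / m ≤ 1 := by
        rw [div_le_one hm']; exact_mod_cast (by omega : k ≤ m)
      have h1 := le_real_Iic_quantile hF ((k : ℝ) / m)
      rw [min_eq_left hk1] at h1
      have h2 := measureReal_mono (μ := F) hsub
      have h3 := measureReal_mono (μ := ν) hsub
      have h4 := (abs_le.1 (hc k (by omega))).1
      have e : ((k + 1 : ℕ) : ℝ) / m - 1 / m = k / m := by push_cast; field_simp; ring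
      rw [e]
      constructor <;> linarith
  rw [abs_le]
  constructor <;> linarith [hup.1, hup.2, hlow.1, hlow.2]

end Quantile

/-- By the layer-cake formula, the integrals of a monotone function differ by at most its range
times the discrepancy of the measures on lower sets. -/
theorem abs_integral_sub_le_of_lowerSet {μ ν : Measure ℝ} [IsProbabilityMeasure μ]
    [IsProbabilityMeasure ν] {ε s : ℝ} (hs : 0 ≤ s)
    (h : ∀ I : Set ℝ, IsLowerSet I → |ν.real I - μ.real I| ≤ ε) {φ : ℝ → ℝ} (hφ : Monotone φ)
    (hφs : ∀ x, φ x ∈ Icc 0 s) : |∫ x, φ x ∂ν - ∫ x, φ x ∂μ| ≤ s * ε := by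
  have hcake : ∀ (ρ : Measure ℝ) [IsProbabilityMeasure ρ],
      ∫ x, φ x ∂ρ = ∫ t in Ioc 0 s, ρ.real {x | t ≤ φ x} := fun ρ _ =>
    Integrable.integral_eq_integral_Ioc_meas_le
      (Integrable.of_mem_Icc 0 s hφ.measurable.aemeasurable (Eventually.of_forall hφs))
      (Eventually.of_forall fun x => (hφs x).1) (Eventually.of_forall fun x => (hφs x).2)
  have hint : ∀ (ρ : Measure ℝ) [IsProbabilityMeasure ρ],
      IntegrableOn (fun t => ρ.real {x | t ≤ φ x}) (Ioc 0 s) := by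
    intro ρ _
    have hanti : Antitone fun t => ρ.real {x | t ≤ φ x} := fun t t' htt' =>
      measureReal_mono fun x (hx : t' ≤ φ x) => htt'.trans hx
    refine Measure.integrableOn_of_bounded (M := 1) (by simp)
      hanti.measurable.aestronglyMeasurable (Eventually.of_forall fun t => ?_)
    rw [Real.norm_eq_abs, abs_of_nonneg measureReal_nonneg]
    exact measureReal_le_one
  rw [hcake μ, hcake ν, ← integral_sub (hint ν) (hint μ), ← Real.norm_eq_abs]
  have hb := norm_setIntegral_le_of_norm_le_const (μ := volume) (s := Ioc 0 s) (C := ε)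
    (f := fun t => ν.real {x | t ≤ φ x} - μ.real {x | t ≤ φ x}) (by simp) ?_
  · simpa [hs, mul_comm] using hb
  · intro t _
    have hlow : IsLowerSet {x | t ≤ φ x}ᶜ := fun x y hyx hx hy => hx (le_trans hy (hφ hyx))
    have hmeas : MeasurableSet {x | t ≤ φ x} := measurableSet_le measurable_const hφ.measurable
    have h1 := h _ hlow
    rw [probReal_compl_eq_one_sub hmeas, probReal_compl_eq_one_sub hmeas] at h1
    rw [Real.norm_eq_abs, abs_sub_comm]
    refine le_trans (le_of_eq ?_) h1
    congr 1; ring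

/-! ### Empirical measures -/

/-- The empirical distribution of the first `n` terms of a sequence. -/
noncomputable def empMeas (n : ℕ) (x : ℕ → ℝ) : Measure ℝ :=
  (n : ℝ≥0∞)⁻¹ • ∑ i ∈ Finset.range n, Measure.dirac (x i)

theorem isProbabilityMeasure_empMeas {n : ℕ} (hn : 0 < n) (x : ℕ → ℝ) :
    IsProbabilityMeasure (empMeas n x) := by
  constructor
  have : (n : ℝ≥0∞) ≠ 0 := by exact_mod_cast hn.ne'
  simp [empMeas, ENNReal.inv_mul_cancel this]

theorem integral_empMeas (n : ℕ) (x : ℕ → ℝ) (φ : ℝ → ℝ) :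
    ∫ y, φ y ∂(empMeas n x) = (∑ i ∈ Finset.range n, φ (x i)) / n := by
  rw [empMeas, integral_smul_measure, integral_finsetSum_measure]
  · simp [div_eq_inv_mul]
  · intro i _
    exact integrable_dirac (by simp [enorm_lt_top])

theorem real_empMeas (n : ℕ) (x : ℕ → ℝ) {S : Set ℝ} (hS : MeasurableSet S) :
    (empMeas n x).real S = (∑ i ∈ Finset.range n, S.indicator (fun _ => (1 : ℝ)) (x i)) / n := by
  rw [← integral_empMeas, integral_indicator_const _ hS, smul_eq_mul, mul_one]

/-! ### Concentration of empirical frequencies -/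

theorem integral_indicator_comp {F : Measure ℝ} {Ω : Type*} [MeasurableSpace Ω]
    {P : Measure Ω} {X : ℕ → Ω → ℝ} (hX : ∀ i, Measurable (X i))
    (hlaw : ∀ i, P.map (X i) = F) {S : Set ℝ} (hS : MeasurableSet S) (i : ℕ) :
    ∫ ω, S.indicator (fun _ => (1 : ℝ)) (X i ω) ∂P = F.real S := by
  have hm : Measurable (S.indicator fun _ => (1 : ℝ)) := measurable_const.indicator hS
  rw [← integral_map (hX i).aemeasurable hm.aestronglyMeasurable, hlaw,
    integral_indicator_const _ hS, smul_eq_mul, mul_one]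

section Concentration

variable {F : Measure ℝ} {Ω : Type*} [MeasurableSpace Ω]
  {P : Measure Ω} [IsProbabilityMeasure P] {X : ℕ → Ω → ℝ}

/-- Hoeffding's inequality for the empirical frequency of a set. -/
theorem prob_empMeas_deviation_le (hX : ∀ i, Measurable (X i)) (hlaw : ∀ i, P.map (X i) = F)
    (hind : iIndepFun X P) {S : Set ℝ} (hS : MeasurableSet S) {n : ℕ} (hn : 0 < n) {ε : ℝ}
    (hε : 0 ≤ ε) :
    P.real {ω | ε < |(empMeas n fun i => X i ω).real S - F.real S|}
      ≤ 2 * Real.exp (-2 * n * ε ^ 2) := by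
  have hn' : (0 : ℝ) < n := by exact_mod_cast hn
  have hm : Measurable (S.indicator fun _ => (1 : ℝ)) := measurable_const.indicator hS
  set Y : ℕ → Ω → ℝ := fun i ω => S.indicator (fun _ => (1 : ℝ)) (X i ω) - F.real S with hY
  have hsub : ∀ i, HasSubgaussianMGF (Y i) (1 / 4) P := by
    intro i
    have h := hasSubgaussianMGF_of_mem_Icc (μ := P) (a := 0) (b := 1)
      (X := fun ω => S.indicator (fun _ => (1 : ℝ)) (X i ω)) (hm.comp (hX i)).aemeasurable
      (Eventually.of_forall fun ω => ⟨indicator_nonneg (by simp) _,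
        indicator_le_self' (by simp) _⟩)
    rw [integral_indicator_comp hX hlaw hS i] at h
    convert h using 1
    simp; norm_num
  have hindY : iIndepFun Y P := hind.comp (fun _ y => S.indicator (fun _ => (1 : ℝ)) y - F.real S)
    fun _ => hm.sub_const _
  have hindY' : iIndepFun (fun i => -Y i) P :=
    hindY.comp (fun _ y => -y) fun _ => measurable_neg
  have h1 := HasSubgaussianMGF.measure_sum_range_ge_le_of_iIndepFun hindY (n := n)
    (fun i _ => hsub i) (ε := n * ε) (by positivity)
  have h2 := HasSubgaussianMGF.measure_sum_range_ge_le_of_iIndepFun hindY' (n := n)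
    (fun i _ => (hsub i).neg) (ε := n * ε) (by positivity)
  have e : -(n * ε) ^ 2 / (2 * n * ((1 / 4 : ℝ≥0) : ℝ)) = -2 * n * ε ^ 2 := by
    push_cast; field_simp; ring
  rw [e] at h1 h2
  have hcover : {ω | ε < |(empMeas n fun i => X i ω).real S - F.real S|} ⊆
      {ω | n * ε ≤ ∑ i ∈ Finset.range n, Y i ω} ∪
      {ω | n * ε ≤ ∑ i ∈ Finset.range n, (-Y i) ω} := by
    intro ω hω
    have hsum : (empMeas n fun i => X i ω).real S - F.real S
        = (∑ i ∈ Finset.range n, Y i ω) / n := by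
      rw [real_empMeas _ _ hS]
      simp only [hY, Finset.sum_sub_distrib, Finset.sum_const, Finset.card_range, nsmul_eq_mul]
      field_simp
    rw [mem_ofPred_eq, hsum, lt_abs] at hω
    rcases hω with hω | hω
    · left
      rw [lt_div_iff₀ hn'] at hω
      rw [mem_ofPred_eq]; linarith
    · right
      rw [← neg_div, lt_div_iff₀ hn'] at hω
      simp only [mem_ofPred_eq, Pi.neg_apply, Finset.sum_neg_distrib]
      linarith
  calc _ ≤ _ := measureReal_mono hcover
    _ ≤ _ := measureReal_union_le _ _
    _ ≤ _ := by linarith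

/-- A Chernoff bound for the upper tail of the empirical frequency of a set of small mass. -/
theorem prob_lt_sum_indicator_le (hX : ∀ i, Measurable (X i)) (hlaw : ∀ i, P.map (X i) = F)
    (hind : iIndepFun X P) {S : Set ℝ} (hS : MeasurableSet S) (n : ℕ) {γ a : ℝ}
    (hγ : 0 < γ) (ha : F.real S + γ ≤ a) :
    P.real {ω | n * a < ∑ i ∈ Finset.range n, S.indicator (fun _ => (1 : ℝ)) (X i ω)}
      ≤ Real.exp (-(n * γ ^ 2 / (4 * a))) := by
  set p := F.real S with hp
  have hp0 : 0 ≤ p := measureReal_nonneg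
  have ha0 : 0 < a := by linarith
  have hm : Measurable (S.indicator fun _ => (1 : ℝ)) := measurable_const.indicator hS
  set Y : ℕ → Ω → ℝ := fun i ω => S.indicator (fun _ => (1 : ℝ)) (X i ω) with hY
  have hYm : ∀ i, Measurable (Y i) := fun i => hm.comp (hX i)
  have hindY : iIndepFun Y P := hind.comp (fun _ y => S.indicator (fun _ => (1 : ℝ)) y) fun _ => hm
  -- the minimizer over `t` of `p (t + t ^ 2) - t a`, up to replacing `p` by `a`
  set t := γ / (2 * a) with ht
  have ht0 : 0 ≤ t := by positivity
  have ht1 : t ≤ 1 := by rw [ht, div_le_one (by positivity)]; linarith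
  have hexp : Real.exp t ≤ 1 + t + t ^ 2 := by
    have := (abs_le.1 (Real.abs_exp_sub_one_sub_id_le (x := t) (by rwa [abs_of_nonneg ht0]))).2
    linarith
  have hmgf : ∀ i, mgf (Y i) P t ≤ Real.exp (p * (t + t ^ 2)) := by
    intro i
    have e : ∀ ω, Real.exp (t * Y i ω) = 1 + (Real.exp t - 1) * Y i ω := by
      intro ω
      by_cases h : X i ω ∈ S <;> simp [hY, h]
    have hint : Integrable (Y i) P := Integrable.of_mem_Icc 0 1 (hYm i).aemeasurable
      (Eventually.of_forall fun ω => ⟨indicator_nonneg (by simp) _, indicator_le_self' (by simp) _⟩)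
    have hval : mgf (Y i) P t = 1 + (Real.exp t - 1) * p := by
      rw [mgf, integral_congr_ae (Eventually.of_forall e),
        integral_add (integrable_const _) (hint.const_mul _), integral_const_mul,
        integral_indicator_comp hX hlaw hS i]
      simp [hp]
    rw [hval]
    have := Real.add_one_le_exp (p * (t + t ^ 2))
    nlinarith
  have hbd := measure_ge_le_exp_mul_mgf (μ := P) (X := ∑ i ∈ Finset.range n, Y i) (t := t)
    (n * a) ht0 (hindY.integrable_exp_mul_sum hYm fun i _ =>
      integrable_exp_mul_of_mem_Icc (a := 0) (b := 1) (hYm i).aemeasurable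
      (Eventually.of_forall fun ω =>
        ⟨indicator_nonneg (by simp) _, indicator_le_self' (by simp) _⟩))
  rw [hindY.mgf_sum hYm] at hbd
  have hprod : ∏ i ∈ Finset.range n, mgf (Y i) P t ≤ Real.exp (p * (t + t ^ 2)) ^ n := by
    calc _ ≤ ∏ _i ∈ Finset.range n, Real.exp (p * (t + t ^ 2)) :=
          Finset.prod_le_prod (fun i _ => mgf_nonneg) fun i _ => hmgf i
      _ = _ := by simp
  refine le_trans (measureReal_mono fun ω hω => ?_) (hbd.trans ((mul_le_mul_of_nonneg_left hprod
    (Real.exp_pos _).le).trans ?_))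
  · rw [mem_ofPred_eq, Finset.sum_apply]
    exact le_of_lt hω
  · rw [← Real.exp_nat_mul, ← Real.exp_add, Real.exp_le_exp]
    have hta : t * a = γ / 2 := by rw [ht]; field_simp
    have e1 : n * γ ^ 2 / (4 * a) = n * (t * γ / 2) := by rw [ht]; field_simp; ring
    rw [e1]
    have hn0 : (0 : ℝ) ≤ n := Nat.cast_nonneg n
    have key : -t * a + p * (t + t ^ 2) ≤ -(t * γ / 2) := by
      have h1 : t * (p + γ) ≤ t * a := mul_le_mul_of_nonneg_left ha ht0
      have h2 : t * (t * p) ≤ t * (γ / 2) :=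
        mul_le_mul_of_nonneg_left (by rw [← hta]; nlinarith) ht0
      nlinarith
    calc -t * (n * a) + n * (p * (t + t ^ 2)) = n * (-t * a + p * (t + t ^ 2)) := by ring
      _ ≤ n * -(t * γ / 2) := mul_le_mul_of_nonneg_left key hn0
      _ = _ := by ring

end Concentration

/-! ### The truncated sum of order statistics -/

/-- If few bids exceed the reserve by more than `s`, then truncating the sample at the rank `q n`
and capping the excesses at `s` give nearly the same sum. -/
theorem abs_truncSum_sub_sum_min_le {n : ℕ} (X : Fin n → ℝ) {q r s : ℝ} (hq : q ∈ Icc (0 : ℝ) 1)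
    (hs : 0 ≤ s)
    (hcount : ((Finset.univ.filter fun i => s < X i - r).card : ℝ) ≤ n * (1 - q)) :
    |truncSum q r X - ∑ i, min (max (X i - r) 0) s| ≤ s * (n * (1 - q) + 1) := by
  set σ := Tuple.sort X with hσ
  have hmono : Monotone (X ∘ σ) := Tuple.monotone_sort X
  set k := ⌊q * n⌋₊ with hk
  have hqn : 0 ≤ q * n := mul_nonneg hq.1 (Nat.cast_nonneg n)
  have hkle : (k : ℝ) ≤ q * n := Nat.floor_le hqn
  have hklt : q * n < k + 1 := Nat.lt_floor_add_one _
  have hkn : k ≤ n := by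
    have : (k : ℝ) ≤ n := hkle.trans (mul_le_of_le_one_left (Nat.cast_nonneg n) hq.2)
    exact_mod_cast this
  have hsmall : ∀ i : Fin n, (i : ℕ) < k → X (σ i) - r ≤ s := by
    intro i hi
    by_contra! hlt
    have hsub : (Finset.Ici i).map σ.toEmbedding ⊆ Finset.univ.filter fun i => s < X i - r := by
      intro j hj
      obtain ⟨l, hl, rfl⟩ := Finset.mem_map.1 hj
      have : X (σ i) ≤ X (σ l) := hmono (Finset.mem_Ici.1 hl)
      simp only [Finset.mem_filter, Finset.mem_univ, true_and, Equiv.coe_toEmbedding]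
      linarith
    have hcard := Finset.card_le_card hsub
    rw [Finset.card_map, Fin.card_Ici] at hcard
    have h1 : (n : ℝ) - i ≤ n * (1 - q) := by
      refine le_trans ?_ hcount
      rw [← Nat.cast_sub i.2.le]
      exact_mod_cast hcard
    have h2 : (i : ℝ) + 1 ≤ k := by exact_mod_cast hi
    nlinarith
  have hsum : ∑ i, min (max (X i - r) 0) s = ∑ i, min (max (X (σ i) - r) 0) s :=
    (Equiv.sum_comp σ fun i => min (max (X i - r) 0) s).symm
  have htrunc : truncSum q r X
      = ∑ i ∈ Finset.univ.filter (fun i : Fin n => (i : ℕ) < k), min (max (X (σ i) - r) 0) s := by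
    refine Finset.sum_congr rfl fun i hi => ?_
    rw [min_eq_left]
    exact max_le (hsmall i (Finset.mem_filter.1 hi).2) hs
  rw [hsum, htrunc, ← Finset.sum_filter_add_sum_filter_not Finset.univ
    (fun i : Fin n => (i : ℕ) < k) fun i => min (max (X (σ i) - r) 0) s,
    abs_sub_comm, add_sub_cancel_left, abs_of_nonneg
    (Finset.sum_nonneg fun i _ => le_min (le_max_right _ _) hs)]
  have hcard : ((Finset.univ.filter fun i : Fin n => ¬ (i : ℕ) < k).card : ℝ) = n - k := by
    have h1 := Finset.card_filter_add_card_filter_not (s := (Finset.univ : Finset (Fin n)))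
      (fun i : Fin n => (i : ℕ) < k)
    rw [Fin.card_filter_val_lt, min_eq_right hkn, Finset.card_univ, Fintype.card_fin] at h1
    rw [eq_sub_iff_add_eq']
    exact_mod_cast h1
  calc _ ≤ ∑ _i ∈ Finset.univ.filter (fun i : Fin n => ¬ (i : ℕ) < k), s :=
        Finset.sum_le_sum fun i _ => min_le_right _ _
    _ = (n - k) * s := by rw [Finset.sum_const, nsmul_eq_mul, hcard]
    _ ≤ _ := by rw [mul_comm]; exact mul_le_mul_of_nonneg_left (by linarith) hs

/-! ### Accuracy of the gradient estimate on typical samples -/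

/-- A sample of `n` values is typical if it lies in `[0, 1]`, its empirical distribution is within
`ε` of `F` on all lower sets, and at most `(1 - q) n` of its values exceed `s`. -/
def Typical (F : Measure ℝ) (q s ε : ℝ) (n : ℕ) (x : ℕ → ℝ) : Prop :=
  (∀ i < n, x i ∈ Icc (0 : ℝ) 1) ∧
  (∀ I : Set ℝ, IsLowerSet I → |(empMeas n x).real I - F.real I| ≤ ε) ∧
  ∑ i ∈ Finset.range n, (Ioi s).indicator (fun _ => (1 : ℝ)) (x i) ≤ n * (1 - q)

section Accuracy

variable {F : Measure ℝ} [IsProbabilityMeasure F] {b : ℝ → ℝ → ℝ} {q s ε r : ℝ} {n : ℕ}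

/-- The excess of a bid over the reserve is at most the value, so that capping it at `s` changes its
mean by at most the mass above `s`. -/
theorem abs_integral_min_sub_integral_le (hF : F (Icc (0 : ℝ) 1) = 1)
    (hbm : Measurable (Function.uncurry b)) (hb : IsBiddingFunction b) (hr : r ∈ Icc (0 : ℝ) 1)
    (hs : 0 ≤ s) :
    |∫ v, min (max (b r v - r) 0) s ∂F - ∫ v, max (b r v - r) 0 ∂F| ≤ F.real (Ioi s) := by
  have h := ae_mem_unit hF
  have hbr : Measurable (b r) := hbm.comp measurable_prodMk_left
  have hle : ∀ v ∈ Icc (0 : ℝ) 1, max (b r v - r) 0 ≤ v := fun v hv =>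
    max_le (by linarith [hb.le_value r hr v hv, hr.1]) hv.1
  have hint : Integrable (fun v => max (b r v - r) 0) F :=
    Integrable.of_mem_Icc 0 1 (by fun_prop)
      (h.mono fun v hv => ⟨le_max_right _ _, (hle v hv).trans hv.2⟩)
  have hint' : Integrable (fun v => min (max (b r v - r) 0) s) F :=
    Integrable.of_mem_Icc 0 1 (by fun_prop) (h.mono fun v hv =>
      ⟨le_min (le_max_right _ _) hs, (min_le_left _ _).trans ((hle v hv).trans hv.2)⟩)
  have e : F.real (Ioi s) = ∫ v, (Ioi s).indicator (fun _ => (1 : ℝ)) v ∂F := by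
    rw [integral_indicator_const _ measurableSet_Ioi, smul_eq_mul, mul_one]
  rw [← integral_sub hint' hint, e, ← Real.norm_eq_abs]
  refine norm_integral_le_of_norm_le ((integrable_const _).indicator measurableSet_Ioi)
    (h.mono fun v hv => ?_)
  rw [Real.norm_eq_abs]
  have h1 := hle v hv
  have h0 : 0 ≤ max (b r v - r) 0 := le_max_right _ _
  by_cases hvs : s < v
  · rw [indicator_of_mem (mem_Ioi.2 hvs), abs_le]
    have := le_min h0 hs
    have := min_le_left (max (b r v - r) 0) s
    constructor <;> linarith [hv.2]
  · rw [indicator_of_notMem (fun h => hvs (mem_Ioi.1 h)), min_eq_left (by linarith), sub_self,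
      abs_zero]

/-- On a typical sample the truncated mean is accurate for every reserve: the capped excess is
monotone in the value, so its sample mean is controlled uniformly in the reserve. -/
theorem abs_truncSum_sub_integral_le (hF : F (Icc (0 : ℝ) 1) = 1)
    (hbm : Measurable (Function.uncurry b)) (hb : IsBiddingFunction b) (hr : r ∈ Icc (0 : ℝ) 1)
    (hq : q ∈ Icc (0 : ℝ) 1) (hs : s ∈ Icc (0 : ℝ) 1) (hsq : F.real (Ioi s) ≤ 1 - q)
    (hn : 0 < n) {x : ℕ → ℝ} (hx : Typical F q s ε n x) :
    |truncSum q r (fun i : Fin n => b r (x i)) / n - ∫ v, max (b r v - r) 0 ∂F|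
      ≤ 2 * (1 - q) + s * (ε + 1 / n) := by
  obtain ⟨hx01, hdkw, hcount⟩ := hx
  have hn' : (0 : ℝ) < n := by exact_mod_cast hn
  have := isProbabilityMeasure_empMeas hn x
  set φ : ℝ → ℝ := fun v => min (max (b r (projIcc 0 1 zero_le_one v) - r) 0) s with hφ
  have hφeq : ∀ v ∈ Icc (0 : ℝ) 1, φ v = min (max (b r v - r) 0) s := fun v hv => by
    simp only [hφ, projIcc_of_mem zero_le_one hv]
  have hφmono : Monotone φ := fun v w hvw => by
    have := hb.mono r hr (projIcc (0 : ℝ) 1 zero_le_one v).2 (projIcc (0 : ℝ) 1 zero_le_one w).2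
      (monotone_projIcc zero_le_one hvw)
    exact min_le_min_right _ (max_le_max_right _ (by linarith))
  have h1 := abs_integral_sub_le_of_lowerSet (μ := F) (ν := empMeas n x) hs.1 hdkw hφmono
    fun v => ⟨le_min (le_max_right _ _) hs.1, min_le_right _ _⟩
  have hFφ : ∫ v, φ v ∂F = ∫ v, min (max (b r v - r) 0) s ∂F :=
    integral_congr_ae ((ae_mem_unit hF).mono hφeq)
  have hsumφ : ∑ i ∈ Finset.range n, φ (x i) = ∑ i : Fin n, min (max (b r (x i) - r) 0) s := by
    rw [← Fin.sum_univ_eq_sum_range (fun i => φ (x i))]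
    exact Finset.sum_congr rfl fun i _ => hφeq _ (hx01 i i.2)
  rw [integral_empMeas, hFφ, hsumφ] at h1
  have h2 := abs_integral_min_sub_integral_le hF hbm hb hr hs.1
  have h3 := abs_truncSum_sub_sum_min_le (fun i : Fin n => b r (x i)) (r := r) hq hs.1 (by
    refine le_trans ?_ hcount
    rw [← Fin.sum_univ_eq_sum_range (fun i => (Ioi s).indicator (fun _ => (1 : ℝ)) (x i)),
      Finset.card_filter, Nat.cast_sum]
    refine Finset.sum_le_sum fun i _ => ?_
    split_ifs with h
    · have : s < x i := by linarith [hb.le_value r hr _ (hx01 i i.2), hr.1]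
      simp [this]
    · exact_mod_cast indicator_nonneg (by simp) _)
  have h4 : |truncSum q r (fun i : Fin n => b r (x i)) / n
      - (∑ i : Fin n, min (max (b r (x i) - r) 0) s) / n| ≤ (1 - q) + s * (1 / n) := by
    rw [← sub_div, abs_div, abs_of_pos hn', div_le_iff₀ hn']
    refine h3.trans ?_
    have e : (1 - q + s * (1 / n)) * n = n * (1 - q) + s := by field_simp
    rw [e]
    nlinarith [mul_nonneg hn'.le (sub_nonneg.2 hq.2), hs.2]
  rw [abs_le] at *
  constructor <;> linarith [h1.1, h1.2, h2.1, h2.2, h4.1, h4.2]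

theorem resUp_eq {δ r : ℝ} (hr : r ≠ 0) : resUp δ r = r + δ / 2 := by
  unfold resUp perturb; field_simp

theorem resDown_eq {δ r : ℝ} (hr : r ≠ 0) : resDown δ r = r - δ / 2 := by
  unfold resDown perturb; field_simp

/-- The error of the gradient estimate: truncation and sampling, the bias of the demand part, and
the discretization of the derivative. -/
theorem abs_gradEst_sub_le {L : ℝ≥0} {f : ℝ → ℝ} {δ εD : ℝ} (hF : F (Icc (0 : ℝ) 1) = 1)
    (hbm : Measurable (Function.uncurry b)) (hb : IsBiddingFunction b)
    (hsm : IsSmoothOnUnit L (revenue F b))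
    (hq : q ∈ Icc (0 : ℝ) 1) (hs : s ∈ Icc (0 : ℝ) 1) (hsq : F.real (Ioi s) ≤ 1 - q)
    (hn : 0 < n) (hδ : 0 < δ) (h0 : 0 ≤ r - δ / 2) (h1 : r + δ / 2 ≤ 1)
    (hD : demandBias F f δ r ≤ εD / δ) {xp xm : ℕ → ℝ}
    (hxp : Typical F q s ε n xp) (hxm : Typical F q s ε n xm) :
    |bidGradEst q (resUp δ r) (resDown δ r) (fun i : Fin n => b (resUp δ r) (xp i))
        (fun i : Fin n => b (resDown δ r) (xm i)) + demandGrad f (resUp δ r) (resDown δ r)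
        - derivWithin (revenue F b) (Icc 0 1) r|
      ≤ (4 * (1 - q) + 2 * (s * (ε + 1 / n))) / δ + (1 - q) + εD / δ + L * δ := by
  have hr0 : r ≠ 0 := by linarith
  have hn' : (0 : ℝ) < n := by exact_mod_cast hn
  rw [demandBias] at hD
  rw [resUp_eq hr0, resDown_eq hr0] at *
  have hp01 : r + δ / 2 ∈ Icc (0 : ℝ) 1 := ⟨by linarith, h1⟩
  have hm01 : r - δ / 2 ∈ Icc (0 : ℝ) 1 := ⟨h0, by linarith⟩
  have hp := abs_truncSum_sub_integral_le hF hbm hb hp01 hq hs hsq hn hxp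
  have hm := abs_truncSum_sub_integral_le hF hbm hb hm01 hq hs hsq hn hxm
  have hdisc := hsm.abs_symmDiffQuot_sub_le hδ h0 h1
  rw [revenue_eq hF hbm hb hp01, revenue_eq hF hbm hb hm01] at hdisc
  set tp := truncSum q (r + δ / 2) fun i : Fin n => b (r + δ / 2) (xp i)
  set tm := truncSum q (r - δ / 2) fun i : Fin n => b (r - δ / 2) (xm i)
  set ep := ∫ v, max (b (r + δ / 2) v - (r + δ / 2)) 0 ∂F
  set em := ∫ v, max (b (r - δ / 2) v - (r - δ / 2)) 0 ∂F
  have hδe : r + δ / 2 - (r - δ / 2) = δ := by ring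
  rw [bidGradEst, demandGrad, hδe]
  rw [demandGrad, demandGrad, hδe] at hD
  have hbid : |((tp / n - ep) - (tm / n - em)) / δ|
      ≤ (4 * (1 - q) + 2 * (s * (ε + 1 / n))) / δ := by
    rw [abs_div, abs_of_pos hδ]
    gcongr
    refine (abs_sub _ _).trans ?_
    linarith
  have e1 : (tp - tm) / (n * δ) = ((tp / n - ep) - (tm / n - em)) / δ + (ep - em) / δ := by
    field_simp; ring
  have e2 : (ep + (r + δ / 2) * demand F (r + δ / 2)
      - (em + (r - δ / 2) * demand F (r - δ / 2))) / δ = (ep - em) / δ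
      + ((r + δ / 2) * demand F (r + δ / 2) - (r - δ / 2) * demand F (r - δ / 2)) / δ := by
    rw [← add_div]; congr 1; ring
  rw [e1]
  rw [e2] at hdisc
  rw [abs_le] at *
  constructor <;> linarith [hbid.1, hbid.2, hD.1, hD.2, hdisc.1, hdisc.2, hq.2]

end Accuracy

/-! ### Typical samples are likely -/

section Likely

variable {F : Measure ℝ} {Ω : Type*} [MeasurableSpace Ω] {P : Measure Ω} {X : ℕ → Ω → ℝ}

theorem prob_lt_sum_indicator_eq_zero (hX : ∀ i, Measurable (X i)) (hlaw : ∀ i, P.map (X i) = F)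
    {S : Set ℝ} (hS0 : F S = 0) (n : ℕ) {c : ℝ} (hc : 0 ≤ c) :
    P.real {ω | c < ∑ i ∈ Finset.range n, S.indicator (fun _ => (1 : ℝ)) (X i ω)} = 0 := by
  have hae : ∀ᵐ ω ∂P, ∀ i, X i ω ∉ S := by
    rw [ae_all_iff]
    intro i
    have h : ∀ᵐ y ∂(P.map (X i)), y ∉ S := by
      rw [hlaw]
      exact measure_eq_zero_iff_ae_notMem.1 hS0
    exact ae_of_ae_map (hX i).aemeasurable h
  rw [Measure.real, ENNReal.toReal_eq_zero_iff]
  left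
  refine measure_mono_null (fun ω hω => ?_) (ae_iff.1 hae)
  intro hno
  have h0 : ∑ i ∈ Finset.range n, S.indicator (fun _ => (1 : ℝ)) (X i ω) = 0 :=
    Finset.sum_eq_zero fun i _ => indicator_of_notMem (hno i) _
  rw [mem_ofPred_eq, h0] at hω
  linarith

variable [IsProbabilityMeasure F] [IsProbabilityMeasure P]

theorem real_Ioi_quantile_le (hF : F (Icc (0 : ℝ) 1) = 1) (p : ℝ) :
    F.real (Ioi (quantile F p)) ≤ 1 - min p 1 := by
  have h1 := le_real_Iic_quantile hF p
  rw [← compl_Iic, probReal_compl_eq_one_sub measurableSet_Iic]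
  linarith

/-- If `1 - q` is small, it is unlikely that more than `(1 - q) n` values exceed the quantile of
level `q + γ`: the expected number is smaller by `γ n`, and the variance of the count is at most
`(1 - q) n`. -/
theorem prob_lt_sum_indicator_quantile_le (hF : F (Icc (0 : ℝ) 1) = 1)
    (hX : ∀ i, Measurable (X i)) (hlaw : ∀ i, P.map (X i) = F) (hind : iIndepFun X P) (n : ℕ)
    {q γ c : ℝ} (hq : q ≤ 1) (hγ : 0 < γ) (hc : 1 - q ≤ c) :
    P.real {ω | n * (1 - q) < ∑ i ∈ Finset.range n,
      (Ioi (quantile F (q + γ))).indicator (fun _ => (1 : ℝ)) (X i ω)}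
      ≤ Real.exp (-(n * γ ^ 2 / (4 * c))) := by
  have hp := real_Ioi_quantile_le hF (q + γ)
  rcases le_or_gt (q + γ) 1 with h1 | h1
  · rw [min_eq_left h1] at hp
    refine (prob_lt_sum_indicator_le hX hlaw hind measurableSet_Ioi n hγ (a := 1 - q)
      (by linarith)).trans (Real.exp_le_exp.2 (neg_le_neg ?_))
    have : 0 < 1 - q := by linarith
    gcongr
  · rw [min_eq_right h1.le, sub_self] at hp
    have h0 : F (Ioi (quantile F (q + γ))) = 0 := by
      have := le_antisymm hp measureReal_nonneg
      rwa [Measure.real, ENNReal.toReal_eq_zero_iff, or_iff_left (measure_ne_top _ _)] at this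
    rw [prob_lt_sum_indicator_eq_zero hX hlaw h0 n
      (mul_nonneg (Nat.cast_nonneg n) (sub_nonneg.2 hq))]
    exact (Real.exp_pos _).le

/-- A union bound over the `2 n` closed and open quantile rays of levels `j / n`, `j < n`. -/
theorem prob_not_typical_le (hF : F (Icc (0 : ℝ) 1) = 1)
    (hX : ∀ i, Measurable (X i)) (hlaw : ∀ i, P.map (X i) = F) (hind : iIndepFun X P) {n : ℕ}
    (hn : 0 < n) {q s ε : ℝ} (hε : 0 ≤ ε) :
    P.real {ω | ¬ Typical F q s (ε + 1 / n) n fun i => X i ω}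
      ≤ 4 * n * Real.exp (-2 * n * ε ^ 2)
        + P.real {ω | n * (1 - q) < ∑ i ∈ Finset.range n,
            (Ioi s).indicator (fun _ => (1 : ℝ)) (X i ω)} := by
  set Z := {ω | n * (1 - q) < ∑ i ∈ Finset.range n,
            (Ioi s).indicator (fun _ => (1 : ℝ)) (X i ω)}
  set A : Set ℝ → Set Ω := fun S => {ω | ε < |(empMeas n fun i => X i ω).real S - F.real S|}
  set R : Set Ω := {ω | ¬ ∀ i, X i ω ∈ Icc (0 : ℝ) 1}
  have hR : P.real R = 0 := by
    rw [Measure.real, ENNReal.toReal_eq_zero_iff]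
    left
    refine ae_iff.1 (ae_all_iff.2 fun i => ?_)
    have := ae_mem_unit hF
    rw [← hlaw i] at this
    exact ae_of_ae_map (hX i).aemeasurable this
  have hcover : {ω | ¬ Typical F q s (ε + 1 / n) n fun i => X i ω} ⊆
      ((R ∪ ⋃ j ∈ Finset.range n, A (Iic (quantile F (j / n))))
        ∪ ⋃ j ∈ Finset.range n, A (Iio (quantile F (j / n)))) ∪ Z := by
    intro ω hω
    by_contra hno
    simp only [mem_union, mem_iUnion, not_or, not_exists, Finset.mem_range] at hno
    obtain ⟨⟨⟨hr, hc⟩, ho⟩, hz⟩ := hno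
    refine hω ⟨fun i _ => not_not.1 hr i, fun I hI => ?_, not_lt.1 hz⟩
    have := isProbabilityMeasure_empMeas hn fun i => X i ω
    exact abs_real_sub_le_of_quantile_rays hF hn hε (fun j hj => not_lt.1 (hc j hj))
      (fun j hj => not_lt.1 (ho j hj)) hI
  have hA : ∀ S : ℕ → Set ℝ, (∀ j, MeasurableSet (S j)) →
      P.real (⋃ j ∈ Finset.range n, A (S j)) ≤ n * (2 * Real.exp (-2 * n * ε ^ 2)) := by
    intro S hS
    refine (measureReal_biUnion_finset_le _ _).trans ?_
    refine (Finset.sum_le_sum fun j _ =>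
      prob_empMeas_deviation_le hX hlaw hind (hS j) hn hε).trans (le_of_eq ?_)
    rw [Finset.sum_const, Finset.card_range, nsmul_eq_mul]
  have h1 := hA (fun j => Iic (quantile F (j / n))) fun j => measurableSet_Iic
  have h2 := hA (fun j => Iio (quantile F (j / n))) fun j => measurableSet_Iio
  have h3 := measureReal_mono (μ := P) hcover
  have h4 := measureReal_union_le (μ := P) ((R ∪ ⋃ j ∈ Finset.range n, A (Iic (quantile F (j / n))))
        ∪ ⋃ j ∈ Finset.range n, A (Iio (quantile F (j / n)))) Z
  have h5 := measureReal_union_le (μ := P) (R ∪ ⋃ j ∈ Finset.range n, A (Iic (quantile F (j / n))))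
    (⋃ j ∈ Finset.range n, A (Iio (quantile F (j / n))))
  have h6 := measureReal_union_le (μ := P) R (⋃ j ∈ Finset.range n, A (Iic (quantile F (j / n))))
  linarith

/-- All samples of all rounds are typical with probability at least `1 - η`. -/
theorem le_prob_forall_typical (hF : F (Icc (0 : ℝ) 1) = 1) {V : ℕ × Bool × ℕ → Ω → ℝ}
    (hV : ∀ i, Measurable (V i)) (hlaw : ∀ i, P.map (V i) = F) (hind : iIndepFun V P)
    {N n T : ℕ} (hN : 0 < N) (hn : 0 < n) (hTn : T * n ≤ N) {q s η : ℝ} (hη : 0 < η) (hη1 : η < 1)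
    (htail : ∀ X : ℕ → Ω → ℝ, (∀ i, Measurable (X i)) → (∀ i, P.map (X i) = F) →
      iIndepFun X P → P.real {ω | n * (1 - q) < ∑ i ∈ Finset.range n,
        (Ioi s).indicator (fun _ => (1 : ℝ)) (X i ω)} ≤ Real.exp (-(2 * Real.log (2 * N / η)))) :
    1 - η ≤ P.real {ω | ∀ t < T, ∀ σ, Typical F q s
      (√(2 * Real.log (2 * N / η) / n) + 1 / n) n fun i => V (t, σ, i) ω} := by
  have hN1 : (1 : ℝ) ≤ N := by exact_mod_cast hN
  have hn' : (1 : ℝ) ≤ n := by exact_mod_cast hn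
  have hTn' : (T : ℝ) * n ≤ N := by exact_mod_cast hTn
  have harg : 0 < 2 * N / η := by positivity
  set ℓ := Real.log (2 * N / η) with hℓ
  have hℓ0 : 0 ≤ ℓ := Real.log_nonneg (by rw [le_div_iff₀ hη]; linarith)
  -- in terms of `u`, the two failure probabilities per sample are `4 n u ^ 4` and `u ^ 2`
  set u := η / (2 * N) with hu
  have hu0 : 0 < u := by positivity
  have hexp : ∀ k : ℕ, Real.exp (-(k * ℓ)) = u ^ k := by
    intro k
    rw [Real.exp_neg, Real.exp_nat_mul, hℓ, Real.exp_log harg, ← inv_pow, inv_div]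
  set ε := √(2 * ℓ / n) with hε
  have hε2 : -2 * n * ε ^ 2 = -((4 : ℕ) * ℓ) := by
    rw [hε, Real.sq_sqrt (by positivity)]; push_cast; field_simp; ring
  set B : ℕ → Bool → Set Ω := fun t σ =>
    {ω | ¬ Typical F q s (ε + 1 / n) n fun i => V (t, σ, i) ω}
  have hB : ∀ t σ, P.real (B t σ) ≤ 4 * n * u ^ 4 + u ^ 2 := by
    intro t σ
    have hinj : Function.Injective fun i : ℕ => (t, σ, i) := fun i j h => by simpa using h
    have hi := hind.precomp hinj
    refine (prob_not_typical_le hF (X := fun i => V (t, σ, i)) (fun i => hV _) (fun i => hlaw _) hi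
      hn (Real.sqrt_nonneg _)).trans (add_le_add (le_of_eq ?_) ?_)
    · rw [hε2, hexp]
    · rw [← hexp 2]
      exact_mod_cast htail _ (fun i => hV _) (fun i => hlaw _) hi
  set S := {ω | ∀ t < T, ∀ σ, Typical F q s (ε + 1 / n) n fun i => V (t, σ, i) ω}
  have hcover : univ ⊆ S ∪ ⋃ t ∈ Finset.range T, (B t true ∪ B t false) := by
    intro ω _
    by_contra hno
    simp only [mem_union, mem_iUnion, not_or, not_exists, Finset.mem_range] at hno
    refine hno.1 fun t ht σ => ?_
    cases σ
    · exact not_not.1 (hno.2 t ht).2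
    · exact not_not.1 (hno.2 t ht).1
  have h1 := (measureReal_mono (μ := P) hcover).trans (measureReal_union_le _ _)
  have h2 : P.real (⋃ t ∈ Finset.range T, (B t true ∪ B t false))
      ≤ T * (2 * (4 * n * u ^ 4 + u ^ 2)) := by
    refine (measureReal_biUnion_finset_le _ _).trans ((Finset.sum_le_sum fun t _ =>
      (measureReal_union_le _ _).trans (add_le_add (hB t true) (hB t false))).trans (le_of_eq ?_))
    rw [Finset.sum_const, Finset.card_range, nsmul_eq_mul]
    ring
  rw [probReal_univ] at h1
  have hNu : N * u = η / 2 := by rw [hu]; field_simp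
  have hu1 : u ≤ 1 / 2 := by nlinarith
  have hT : (T : ℝ) ≤ N := le_trans (by nlinarith [Nat.cast_nonneg (α := ℝ) T]) hTn'
  have h3 : (T : ℝ) * (2 * (4 * n * u ^ 4 + u ^ 2)) ≤ η := by
    have e : (T : ℝ) * (2 * (4 * n * u ^ 4 + u ^ 2)) = 8 * (T * n) * u ^ 4 + 2 * T * u ^ 2 := by
      ring
    have hb1 : 8 * (T * n) * u ^ 4 ≤ 8 * N * u ^ 4 := by gcongr
    have hb2 : 2 * T * u ^ 2 ≤ 2 * N * u ^ 2 := by gcongr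
    have hb3 : 8 * N * u ^ 4 = 4 * η * u ^ 3 := by
      calc _ = 8 * (N * u) * u ^ 3 := by ring
        _ = _ := by rw [hNu]; ring
    have hb4 : 2 * N * u ^ 2 = η * u := by
      calc _ = 2 * (N * u) * u := by ring
        _ = _ := by rw [hNu]; ring
    have hb5 : u ^ 3 ≤ (1 / 2) ^ 3 := by gcongr
    nlinarith
  linarith

end Likely

/-! ### Projected gradient ascent on typical samples -/

section Ascent

variable {F : Measure ℝ} {b : ℝ → ℝ → ℝ} {L : ℝ≥0} {C : Set ℝ} {δ r : ℝ}

theorem deriv_revenue_eq (hδ : 0 < δ) (h0 : 0 ≤ r - δ / 2) (h1 : r + δ / 2 ≤ 1) :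
    deriv (revenue F b) r = derivWithin (revenue F b) (Icc 0 1) r :=
  (derivWithin_of_mem_nhds (Icc_mem_nhds (by linarith) (by linarith))).symm

variable [IsProbabilityMeasure F]

theorem gradMap_deriv_revenue_sq_le (hF : F (Icc (0 : ℝ) 1) = 1) (hb : IsBiddingFunction b)
    (hsm : IsSmoothOnUnit L (revenue F b)) (hC : IsClosed C) (hconv : Convex ℝ C) (hδ : 0 < δ)
    (hCδ : ∀ r ∈ C, 0 ≤ r - δ / 2 ∧ r + δ / 2 ≤ 1) (hr : r ∈ C) {α : ℝ} (hα : 0 < α) :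
    |gradMap C r (deriv (revenue F b) r) α| ^ 2 ≤ 4 * (1 + L) ^ 2 := by
  obtain ⟨h0, h1⟩ := hCδ r hr
  have h2 := abs_gradMap_le hC hconv hr hα (deriv (revenue F b) r)
  rw [deriv_revenue_eq hδ h0 h1] at h2 ⊢
  have h3 := hsm.abs_derivWithin_le (fun x hx => revenue_mem_Icc hF hb hx) (x := r)
    ⟨by linarith, by linarith⟩
  calc _ ≤ (2 * (1 + L : ℝ)) ^ 2 := pow_le_pow_left₀ (abs_nonneg _) (h2.trans h3) 2
    _ = _ := by ring

/-- The ascent is analyzed pathwise: typicality of the samples makes the gradient estimates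
accurate at whatever reserves the algorithm visits. -/
theorem exists_gradMap_sq_le_of_typical (hF : F (Icc (0 : ℝ) 1) = 1)
    (hbm : Measurable (Function.uncurry b)) (hb : IsBiddingFunction b)
    (hsm : IsSmoothOnUnit L (revenue F b)) {f : ℝ → ℝ} {q s ε εD r₁ a : ℝ} {n T : ℕ} {α : ℕ → ℝ}
    (hq : q ∈ Icc (0 : ℝ) 1) (hs : s ∈ Icc (0 : ℝ) 1) (hsq : F.real (Ioi s) ≤ 1 - q)
    (hn : 0 < n) (hT : 0 < T) (hδ : 0 < δ) (hC : IsClosed C) (hconv : Convex ℝ C) (hr₁ : r₁ ∈ C)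
    (hCδ : ∀ r ∈ C, 0 ≤ r - δ / 2 ∧ r + δ / 2 ≤ 1)
    (hD : ∀ r ∈ C, demandBias F f δ r ≤ εD / δ) (ha : 0 < a) (hα : ∀ t < T, a ≤ α t)
    (hαL : ∀ t < T, L * α t ≤ 1 / 4) {v : ℕ × Bool × ℕ → ℝ}
    (hv : ∀ t < T, ∀ σ, Typical F q s ε n fun i => v (t, σ, i)) :
    ∃ t < T, |gradMap C (reserve b f q δ n C α r₁ v t)
        (deriv (revenue F b) (reserve b f q δ n C α r₁ v t)) (α t)| ^ 2
      ≤ 8 / (T * a) + 6 * ((4 * (1 - q) + 2 * (s * (ε + 1 / n))) / δ + (1 - q) + εD / δ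
          + L * δ) ^ 2 := by
  have hunit : ∀ x ∈ C, x ∈ Icc (0 : ℝ) 1 := fun x hx =>
    ⟨by linarith [(hCδ x hx).1], by linarith [(hCδ x hx).2]⟩
  -- the update direction at the reserve `x` in round `t`
  set G : ℝ → ℕ → ℝ := fun x t => bidGradEst q (resUp δ x) (resDown δ x)
      (fun i : Fin n => b (resUp δ x) (v (t, true, i)))
      (fun i : Fin n => b (resDown δ x) (v (t, false, i)))
      + demandGrad f (resUp δ x) (resDown δ x) with hG
  have h0 : reserve b f q δ n C α r₁ v 0 = r₁ := rfl
  have hstep : ∀ t, reserve b f q δ n C α r₁ v (t + 1)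
      = proj C (reserve b f q δ n C α r₁ v t + α t * G (reserve b f q δ n C α r₁ v t) t) :=
    fun t => rfl
  generalize reserve b f q δ n C α r₁ v = ρ at h0 hstep ⊢
  have hmem : ∀ t, ρ t ∈ C := by
    intro t
    cases t with
    | zero => rwa [h0]
    | succ t => rw [hstep]; exact (proj_spec hC ⟨r₁, hr₁⟩ _).1
  refine exists_gradMap_sq_le hC hconv (μ := revenue F b) (g := deriv (revenue F b)) (L := L) hT ha
    (hmem 0) hstep (fun x hx => revenue_mem_Icc hF hb (hunit x hx)) ?_ hα hαL ?_
  · intro x hx y hy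
    rw [deriv_revenue_eq hδ (hCδ x hx).1 (hCδ x hx).2]
    have := (abs_le.1 (hsm.abs_taylor_le (hunit x hx) (hunit y hy))).1
    linarith
  · intro t ht
    obtain ⟨h0, h1⟩ := hCδ (ρ t) (hmem t)
    rw [deriv_revenue_eq hδ h0 h1]
    exact abs_gradEst_sub_le (xp := fun i => v (t, true, i)) (xm := fun i => v (t, false, i))
      hF hbm hb hsm hq hs hsq hn hδ h0 h1 (hD _ (hmem t)) (hv t ht true) (hv t ht false)

end Ascent

/-! ### The rate -/

/-- The number of rounds and the number of samples per round in terms of `y = N ^ (1 / 18)`, a root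
of which all powers of `N` in the rate are integral powers. -/
theorem rounds_bounds {N : ℕ} (hN : 1 ≤ N) {y : ℝ} (hy : y = (N : ℝ) ^ (1 / 18 : ℝ)) :
    1 ≤ y ∧ 0 < numRounds N ∧ y ^ 6 / 2 ≤ √(numRounds N) ∧ 0 < samplesPerRound N ∧
      y ^ 6 / 2 ≤ samplesPerRound N ∧ numRounds N * samplesPerRound N ≤ N := by
  have hN1 : (1 : ℝ) ≤ N := by exact_mod_cast hN
  have hy1 : 1 ≤ y := hy ▸ Real.one_le_rpow hN1 (by norm_num)
  have hpow : ∀ k : ℕ, y ^ k = (N : ℝ) ^ ((k : ℝ) / 18) := fun k => by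
    rw [hy, ← Real.rpow_natCast, ← Real.rpow_mul (by positivity)]; congr 1; ring
  have h12 : (N : ℝ) ^ (2 / 3 : ℝ) = y ^ 12 := by rw [hpow]; congr 1; norm_num
  have h18 : (N : ℝ) = y ^ 18 := by rw [hpow]; norm_num
  have hT : numRounds N = ⌊y ^ 12⌋₊ := by rw [numRounds, h12]
  have hy12 : 1 ≤ y ^ 12 := one_le_pow₀ hy1
  have hTle : (numRounds N : ℝ) ≤ y ^ 12 := hT ▸ Nat.floor_le (by positivity)
  have hT0 : 0 < numRounds N := hT ▸ Nat.floor_pos.2 hy12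
  have hT1 : (1 : ℝ) ≤ numRounds N := by exact_mod_cast hT0
  have hTge : y ^ 12 / 2 ≤ numRounds N := by
    have : y ^ 12 < numRounds N + 1 := hT ▸ Nat.lt_floor_add_one _
    linarith
  have hTN : numRounds N ≤ N := by
    have : (numRounds N : ℝ) ≤ N := hTle.trans (h18 ▸ pow_le_pow_right₀ hy1 (by norm_num))
    exact_mod_cast this
  have hn0 : 0 < samplesPerRound N := Nat.div_pos hTN hT0
  have hn1 : (1 : ℝ) ≤ samplesPerRound N := by exact_mod_cast hn0
  refine ⟨hy1, hT0, ?_, hn0, ?_, Nat.mul_div_le N _⟩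
  · refine Real.le_sqrt_of_sq_le (le_trans ?_ hTge)
    have : (y ^ 6 / 2) ^ 2 = y ^ 12 / 4 := by ring
    linarith
  · have h1 : (N : ℝ) < numRounds N * (samplesPerRound N + 1) := by
      exact_mod_cast Nat.lt_mul_div_succ N hT0
    have h2 : y ^ 12 * y ^ 6 < y ^ 12 * (2 * samplesPerRound N) := by
      calc y ^ 12 * y ^ 6 = N := by rw [h18]; ring
        _ < numRounds N * (samplesPerRound N + 1) := h1
        _ ≤ y ^ 12 * (2 * samplesPerRound N) := by gcongr; linarith
    have := lt_of_mul_lt_mul_left h2 (by positivity)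
    linarith

/-- The squared error of the gradient estimate when `δ` is of the order of `√κ`. -/
theorem sq_error_le {L c₁ c₂ κ q δ εD s ℓ : ℝ} {n : ℕ} {z : ℝ} (hL : 0 ≤ L) (hc₁ : 0 < c₁)
    (hκ : κ = εD + 1 - q) (hκ0 : 0 < κ) (hq : q ∈ Icc (0 : ℝ) 1) (hεD : 0 ≤ εD)
    (hδ₁ : c₁ * √κ ≤ δ) (hδ₂ : δ ≤ c₂ * √κ) (hs : 0 ≤ s) (hℓ : 1 / 2 ≤ ℓ) (hn : 0 < n)
    (hz : 0 < z) (hnz : z / 2 ≤ n) :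
    ((4 * (1 - q) + 2 * (s * (√(2 * ℓ / n) + 1 / n + 1 / n))) / δ + (1 - q) + εD / δ
          + L * δ) ^ 2
      ≤ 2 * (5 / c₁ + 1 + L * c₂) ^ 2 * κ + 2 * (2 / c₁) ^ 2 * (s ^ 2 * (36 * ℓ) / (z * κ)) := by
  have hn' : (1 : ℝ) ≤ n := by exact_mod_cast hn
  have hw0 : 0 < √κ := Real.sqrt_pos.2 hκ0
  have hww : √κ * √κ = κ := Real.mul_self_sqrt hκ0.le
  set w := √κ with hw
  have hδ0 : 0 < δ := (mul_pos hc₁ hw0).trans_le hδ₁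
  set e := √(2 * ℓ / n) + 1 / n + 1 / n with he
  have he0 : 0 ≤ e := by positivity
  have hdiv : ∀ x, 0 ≤ x → x / δ ≤ x / (c₁ * w) := fun x hx =>
    div_le_div_of_nonneg_left hx (mul_pos hc₁ hw0) hδ₁
  have hdivκ : κ / (c₁ * w) = w / c₁ := by
    rw [← hww]; field_simp
  have hq1 : 0 ≤ 1 - q := sub_nonneg.2 hq.2
  have hb1 : (4 * (1 - q) + 2 * (s * e)) / δ ≤ 4 * (w / c₁) + 2 * (s * e) / (c₁ * w) := by
    refine (hdiv _ (by positivity)).trans ?_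
    rw [add_div, mul_div_assoc]
    refine add_le_add (mul_le_mul_of_nonneg_left ?_ (by norm_num)) le_rfl
    rw [← hdivκ]
    gcongr
    linarith
  have hb2 : 1 - q ≤ w := by
    refine Real.le_sqrt_of_sq_le ?_
    nlinarith [hq.1]
  have hb3 : εD / δ ≤ w / c₁ := by
    refine (hdiv _ hεD).trans ?_
    rw [← hdivκ]
    gcongr
    linarith
  have hb4 : L * δ ≤ L * c₂ * w := by
    rw [mul_assoc]; exact mul_le_mul_of_nonneg_left hδ₂ hL
  have hsum : (4 * (1 - q) + 2 * (s * e)) / δ + (1 - q) + εD / δ + L * δ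
      ≤ (5 / c₁ + 1 + L * c₂) * w + 2 / c₁ * (s * e / w) := by
    have e1 : 2 * (s * e) / (c₁ * w) = 2 / c₁ * (s * e / w) := by field_simp
    rw [e1] at hb1
    have e2 : (5 / c₁ + 1 + L * c₂) * w = 4 * (w / c₁) + w + w / c₁ + L * c₂ * w := by ring
    linarith
  -- the term `1 / n` is dominated by the stochastic term since `2 ℓ ≥ 1`
  have hinv : 1 / (n : ℝ) ≤ √(2 * ℓ / n) := by
    refine Real.le_sqrt_of_sq_le ?_
    rw [div_pow, one_pow, div_le_div_iff₀ (by positivity) (by positivity)]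
    nlinarith
  have he2 : e ^ 2 ≤ 36 * ℓ / z := by
    have h1 : e ≤ 3 * √(2 * ℓ / n) := by linarith
    calc e ^ 2 ≤ (3 * √(2 * ℓ / n)) ^ 2 := pow_le_pow_left₀ he0 h1 2
      _ = 18 * ℓ / n := by rw [mul_pow, Real.sq_sqrt (by positivity)]; ring
      _ ≤ 18 * ℓ / (z / 2) := div_le_div_of_nonneg_left (by linarith) (by positivity) hnz
      _ = _ := by field_simp; norm_num
  have hstoch : (s * e / w) ^ 2 ≤ s ^ 2 * (36 * ℓ) / (z * κ) := by
    rw [div_pow, mul_pow, sq w, hww]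
    calc s ^ 2 * e ^ 2 / κ ≤ s ^ 2 * (36 * ℓ / z) / κ := by gcongr
      _ = _ := by field_simp
  have hlhs0 : 0 ≤ (4 * (1 - q) + 2 * (s * e)) / δ + (1 - q) + εD / δ + L * δ := by positivity
  refine (pow_le_pow_left₀ hlhs0 hsum 2).trans ?_
  refine (add_sq_le).trans ?_
  rw [mul_pow, mul_pow, sq w, hww]
  nlinarith [mul_le_mul_of_nonneg_left hstoch (sq_nonneg (2 / c₁))]

/-- The optimization error and the squared estimation error are both of the order of `R`. -/
theorem rate_le {a A B κ R ℓ z s τ E M : ℝ} (ha : 0 < a) (hz : 0 < z) (hR : 0 ≤ R)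
    (hℓ : 1 / 2 ≤ ℓ) (hκR : κ ≤ R) (hzR : z⁻¹ ≤ R) (hsR : s ^ 2 / (z * κ) ≤ R)
    (hτ : z / 2 ≤ τ) (hE : E ≤ 2 * A ^ 2 * κ + 2 * B ^ 2 * (s ^ 2 * (36 * ℓ) / (z * κ)))
    (hM : 16 / a + 12 * A ^ 2 + 432 * B ^ 2 ≤ M) :
    8 / (a * τ) + 6 * E ≤ 64 * M * ℓ ^ 6 * R := by
  have hℓ6 : 64 * ℓ ^ 6 = (2 * ℓ) ^ 6 := by ring
  have hℓ61 : 1 ≤ 64 * ℓ ^ 6 := hℓ6 ▸ one_le_pow₀ (by linarith)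
  have h1 : 8 / (a * τ) ≤ 16 / a * R := by
    calc 8 / (a * τ) ≤ 8 / (a * (z / 2)) := by gcongr
      _ = 16 / a * z⁻¹ := by field_simp; norm_num
      _ ≤ 16 / a * R := by gcongr
  have h2 : s ^ 2 * (36 * ℓ) / (z * κ) ≤ 36 * ℓ * R := by
    rw [mul_comm (s ^ 2), mul_div_assoc]
    gcongr
  have h3 : ℓ ≤ 64 * ℓ ^ 6 := by
    rw [hℓ6]
    exact le_trans (by linarith) (le_self_pow₀ (by linarith : 1 ≤ 2 * ℓ) (by norm_num))
  have hA := mul_le_mul_of_nonneg_left hκR (sq_nonneg A)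
  have hB := mul_le_mul_of_nonneg_left h2 (sq_nonneg B)
  have hR1 : R ≤ 64 * ℓ ^ 6 * R := le_mul_of_one_le_left hR hℓ61
  calc _ ≤ (16 / a + 12 * A ^ 2) * R + 432 * B ^ 2 * (ℓ * R) := by linarith
    _ ≤ (16 / a + 12 * A ^ 2) * (64 * ℓ ^ 6 * R) + 432 * B ^ 2 * (64 * ℓ ^ 6 * R) := by gcongr
    _ = (16 / a + 12 * A ^ 2 + 432 * B ^ 2) * (64 * ℓ ^ 6 * R) := by ring
    _ ≤ M * (64 * ℓ ^ 6 * R) := by gcongr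
    _ = _ := by ring

/-- A constant is at most the rate if `R` or the logarithm is large enough. -/
theorem const_le_rate {c k M ℓ z R : ℝ} (hc : 0 ≤ c) (hk : 0 ≤ k) (hzR : z⁻¹ ≤ R) (hR : 0 ≤ R)
    (hkz : 1 ≤ k * (64 * ℓ ^ 6) * z⁻¹) (hM : c * k ≤ M) : c ≤ 64 * M * ℓ ^ 6 * R := by
  have hℓ : 0 ≤ ℓ ^ 6 := by positivity
  calc c ≤ c * (k * (64 * ℓ ^ 6) * z⁻¹) := le_mul_of_one_le_right hc hkz
    _ = 64 * (c * k) * ℓ ^ 6 * z⁻¹ := by ring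
    _ ≤ 64 * (c * k) * ℓ ^ 6 * R := by gcongr
    _ ≤ _ := by gcongr

/-- A cap `s` on the excess of a bid over the reserve for which few values exceed `s` and the
sampling error `s ^ 2 / (y ^ 6 * κ)` is of the order of the rate, where `y ^ 18` is the total number
of samples. -/
theorem exists_cap {F : Measure ℝ} [IsProbabilityMeasure F] {Ω : Type*} [MeasurableSpace Ω]
    {P : Measure Ω} [IsProbabilityMeasure P] (hF : F (Icc (0 : ℝ) 1) = 1) {q κ y ℓ : ℝ} {n : ℕ}
    (hq : q ∈ Icc (0 : ℝ) 1) (hκ0 : 0 < κ) (hqκ : 1 - q ≤ κ) (hy0 : 0 < y) (hny : y ^ 6 / 2 ≤ n)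
    (hlog : 16 * ℓ ≤ y) :
    ∃ s ∈ Icc (0 : ℝ) 1, F.real (Ioi s) ≤ 1 - q ∧
      s ^ 2 / (y ^ 6 * κ) ≤ κ + (1 + quantile F (q + (y ^ 4)⁻¹) / κ) * (y ^ 6)⁻¹ ∧
      ∀ X : ℕ → Ω → ℝ, (∀ i, Measurable (X i)) → (∀ i, P.map (X i) = F) → iIndepFun X P →
        P.real {ω | n * (1 - q) < ∑ i ∈ Finset.range n,
          (Ioi s).indicator (fun _ => (1 : ℝ)) (X i ω)} ≤ Real.exp (-(2 * ℓ)) := by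
  have hQ01 := quantile_mem_Icc hF (q + (y ^ 4)⁻¹)
  have hy6 : 0 < (y ^ 6)⁻¹ := by positivity
  have hy4 : 0 < (y ^ 4)⁻¹ := by positivity
  have hQκ : 0 ≤ quantile F (q + (y ^ 4)⁻¹) / κ * (y ^ 6)⁻¹ :=
    mul_nonneg (div_nonneg hQ01.1 hκ0.le) hy6.le
  rcases le_or_gt (y ^ 3)⁻¹ κ with hbig | hsmall
  · -- no cap is needed, as the sampling error `1 / (y ^ 6 * κ)` is at most `κ`
    have h0 : F (Ioi 1) = 0 :=
      measure_mono_null (t := (Icc 0 1)ᶜ) (fun v hv hv' => not_lt.2 hv'.2 hv)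
        ((prob_compl_eq_zero_iff measurableSet_Icc).2 hF)
    refine ⟨1, ⟨zero_le_one, le_rfl⟩, ?_, ?_, ?_⟩
    · rw [Measure.real, h0]
      simpa using hq.2
    · have h1 : 1 ≤ y ^ 3 * κ := by
        rwa [inv_le_iff_one_le_mul₀' (by positivity)] at hbig
      have h2 : 1 ^ 2 / (y ^ 6 * κ) ≤ κ := by
        rw [one_pow, div_le_iff₀ (by positivity)]
        nlinarith
      linarith
    · intro X hX hlawX _
      rw [prob_lt_sum_indicator_eq_zero hX hlawX h0 n
        (mul_nonneg (Nat.cast_nonneg n) (sub_nonneg.2 hq.2))]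
      exact (Real.exp_pos _).le
  · -- `1 - q` is so small that the empirical `q`-quantile is unlikely to exceed this quantile
    refine ⟨quantile F (q + (y ^ 4)⁻¹), hQ01, ?_, ?_, ?_⟩
    · refine (real_Ioi_quantile_le hF _).trans ?_
      have : q ≤ min (q + (y ^ 4)⁻¹) 1 := le_min (by linarith) hq.2
      linarith
    · generalize quantile F (q + (y ^ 4)⁻¹) = Q at hQ01 hQκ ⊢
      have h1 : Q ^ 2 ≤ Q := by nlinarith [hQ01.1, hQ01.2]
      calc Q ^ 2 / (y ^ 6 * κ) ≤ Q / (y ^ 6 * κ) := by gcongr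
        _ = Q / κ * (y ^ 6)⁻¹ := by field_simp
        _ ≤ _ := by linarith
    · intro X hX hlawX hindX
      refine (prob_lt_sum_indicator_quantile_le hF hX hlawX hindX n hq.2
        hy4 (c := (y ^ 3)⁻¹) (by linarith)).trans ?_
      refine Real.exp_le_exp.2 (neg_le_neg ?_)
      have e : n * (y ^ 4)⁻¹ ^ 2 / (4 * (y ^ 3)⁻¹) = n / (4 * y ^ 5) := by field_simp
      rw [e, le_div_iff₀ (by positivity)]
      calc 2 * ℓ * (4 * y ^ 5) = 16 * ℓ * y ^ 5 / 2 := by ring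
        _ ≤ y * y ^ 5 / 2 := by gcongr
        _ = y ^ 6 / 2 := by ring
        _ ≤ n := hny

end ReserveOpt

theorem mainTheorem8 :
    -- the power of the logarithm hidden in the rate is universal; the factor `K` depends only on
    -- the smoothness constant and on the constants in the two `Θ`s
    ∃ k : ℕ, ∀ (L : ℝ≥0) (c₁ c₂ a₁ a₂ : ℝ), 0 < c₁ → 0 < c₂ → 0 < a₁ → 0 < a₂ →
    ∃ K : ℝ, 0 < K ∧
    ∀ (F : Measure ℝ) [IsProbabilityMeasure F] (b : ℝ → ℝ → ℝ) (f : ℝ → ℝ)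
      (q δ εD r₁ : ℝ) (C : Set ℝ) (N : ℕ) (α : ℕ → ℝ)
      (Ω : Type*) [MeasurableSpace Ω] (P : Measure Ω) [IsProbabilityMeasure P]
      (V : ℕ × Bool × ℕ → Ω → ℝ),
      -- the value distribution, the response model, and the learned demand function
      F (Icc (0 : ℝ) 1) = 1 →
      Measurable (Function.uncurry b) →
      IsBiddingFunction b →
      DiminishingSensitivity b →
      IsSmoothOnUnit L (revenue F b) →
      Measurable f →
      -- the parameters
      q ∈ Icc (0 : ℝ) 1 → 0 ≤ εD → 0 < δ → 1 ≤ N →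
      c₁ * √(εD + 1 - q) ≤ δ → δ ≤ c₂ * √(εD + 1 - q) →
      (∀ t < numRounds N,
        a₁ / √(numRounds N : ℝ) ≤ α t ∧ α t ≤ a₂ / √(numRounds N : ℝ)) →
      -- the feasible reserves; all test reserves are reserves in `[0,1]`
      IsClosed C → Convex ℝ C → r₁ ∈ C →
      (∀ r ∈ C, 0 ≤ r - δ / 2 ∧ r + δ / 2 ≤ 1) →
      (∀ r ∈ C, demandBias F f δ r ≤ εD / δ) →
      -- i.i.d. values
      (∀ i, Measurable (V i)) → (∀ i, P.map (V i) = F) → iIndepFun V P →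
      ∀ η : ℝ, 0 < η → η < 1 →
        1 - η ≤ P.real {ω | ∃ t < numRounds N,
          let r := reserve b f q δ (samplesPerRound N) C α r₁ (fun i => V i ω) t
          |gradMap C r (deriv (revenue F b) r) (α t)| ^ 2 ≤
            K * Real.log (2 * N / η) ^ k *
              (εD + 1 - q + (1 + quantile F (q + (N : ℝ) ^ (-(2 / 9) : ℝ)) / (εD + 1 - q)) *
                (N : ℝ) ^ (-(1 / 3) : ℝ))} := by
  refine ⟨6, fun L c₁ c₂ a₁ a₂ hc₁ hc₂ ha₁ ha₂ => ?_⟩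
  set M : ℝ := 16 / a₁ + 12 * (5 / c₁ + 1 + L * c₂) ^ 2 + 432 * (2 / c₁) ^ 2
    + 4 * (1 + L) ^ 2 * (8 ^ 6 + 8 * (L * a₂)) with hM
  have hMpos : 0 < M := by positivity
  have hM0 : 0 ≤ 16 / a₁ + 12 * (5 / c₁ + 1 + L * c₂) ^ 2 + 432 * (2 / c₁) ^ 2 := by positivity
  refine ⟨64 * M, by positivity, ?_⟩
  intro F _ b f q δ εD r₁ C N α Ω _ P _ V hF hbm hb _ hsm _ hq hεD hδ hN hδ₁ hδ₂ hα hC hconv hr₁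
    hCδ hD hV hlaw hind η hη hη1
  set κ := εD + 1 - q with hκ
  -- otherwise the junk value `√κ = 0` would force `δ ≤ 0`
  have hκ0 : 0 < κ := by
    by_contra! h
    rw [Real.sqrt_eq_zero_of_nonpos h, mul_zero] at hδ₂
    linarith
  set y := (N : ℝ) ^ (1 / 18 : ℝ) with hy
  obtain ⟨hy1, hT, hTy, hn, hny, hTn⟩ := rounds_bounds hN hy
  set T := numRounds N
  set n := samplesPerRound N
  have hpow : ∀ k : ℕ, (y ^ k)⁻¹ = (N : ℝ) ^ (-(k : ℝ) / 18) := fun k => by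
    rw [hy, ← Real.rpow_natCast, ← Real.rpow_mul (by positivity),
      ← Real.rpow_neg (by positivity)]
    congr 1; ring
  have h6 : (N : ℝ) ^ (-(1 / 3) : ℝ) = (y ^ 6)⁻¹ := by rw [hpow]; congr 1; norm_num
  have h4 : (N : ℝ) ^ (-(2 / 9) : ℝ) = (y ^ 4)⁻¹ := by rw [hpow]; congr 1; norm_num
  rw [h6, h4]
  set Q := quantile F (q + (y ^ 4)⁻¹) with hQ
  have hQ01 : Q ∈ Icc (0 : ℝ) 1 := quantile_mem_Icc hF _
  set ℓ := Real.log (2 * N / η) with hℓ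
  have hN1 : (1 : ℝ) ≤ N := by exact_mod_cast hN
  have hℓ2 : 1 / 2 ≤ ℓ := by
    have h1 : Real.log 2 ≤ ℓ := Real.log_le_log two_pos (by rw [le_div_iff₀ hη]; nlinarith)
    linarith [Real.log_two_gt_d9]
  have hy0 : 0 < y := by linarith
  have hy6 : 0 < (y ^ 6)⁻¹ := by positivity
  have hTsq : 0 < √(T : ℝ) := Real.sqrt_pos.2 (by exact_mod_cast hT)
  have hα0 : ∀ t < T, 0 < α t := fun t ht => (div_pos ha₁ hTsq).trans_le (hα t ht).1
  set R := κ + (1 + Q / κ) * (y ^ 6)⁻¹ with hR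
  have hQκ : 0 ≤ Q / κ := div_nonneg hQ01.1 hκ0.le
  have hRy : (y ^ 6)⁻¹ ≤ R := by
    rw [hR]; nlinarith [mul_nonneg hQκ hy6.le]
  have hR0 : 0 < R := hy6.trans_le hRy
  have hκR : κ ≤ R := by
    rw [hR]; exact le_add_of_nonneg_right (by positivity)
  have hℓ6 : 64 * ℓ ^ 6 = (2 * ℓ) ^ 6 := by ring
  have hℓ61 : 1 ≤ 64 * ℓ ^ 6 := hℓ6 ▸ one_le_pow₀ (by linarith)
  -- the bound on the derivative settles the cases in which the right-hand side is not small
  have htriv : 4 * (1 + (L : ℝ)) ^ 2 ≤ 64 * M * ℓ ^ 6 * R →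
      1 - η ≤ P.real {ω | ∃ t < T,
          let r := reserve b f q δ n C α r₁ (fun i => V i ω) t
          |gradMap C r (deriv (revenue F b) r) (α t)| ^ 2 ≤ 64 * M * ℓ ^ 6 * R} := by
    intro h
    have huniv : {ω | ∃ t < T,
          let r := reserve b f q δ n C α r₁ (fun i => V i ω) t
          |gradMap C r (deriv (revenue F b) r) (α t)| ^ 2 ≤ 64 * M * ℓ ^ 6 * R} = univ :=
      eq_univ_of_forall fun ω => ⟨0, hT, (gradMap_deriv_revenue_sq_le hF hb hsm hC hconv hδ hCδ
        hr₁ (hα0 0 hT)).trans h⟩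
    rw [huniv, probReal_univ]
    linarith
  -- the ascent lemma needs short steps; they are long only if `N` is bounded in terms of `L * a₂`
  by_cases hstep : L * (a₂ / √(T : ℝ)) ≤ 1 / 4
  swap
  · apply htriv
    have h1 : √(T : ℝ) < 4 * (L * a₂) := by
      rw [not_le, ← mul_div_assoc, lt_div_iff₀ hTsq] at hstep
      linarith
    have h2 : 1 ≤ 8 * (L * a₂) * (y ^ 6)⁻¹ := by
      rw [← div_eq_mul_inv, one_le_div (by positivity)]
      linarith
    refine const_le_rate (by positivity) (by positivity) hRy hR0.le (k := 8 * (L * a₂)) ?_ ?_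
    · rw [mul_right_comm]
      exact one_le_mul_of_one_le_of_one_le h2 hℓ61
    · rw [hM]
      have : 0 ≤ 4 * (1 + (L : ℝ)) ^ 2 * 8 ^ 6 := by positivity
      linarith
  -- the tail bound of `exists_cap` needs the logarithm to be small compared with `y`
  by_cases hlog : 16 * ℓ ≤ y
  swap
  · apply htriv
    have h2 : 1 ≤ 8 ^ 6 * (64 * ℓ ^ 6) * (y ^ 6)⁻¹ := by
      rw [← div_eq_mul_inv, one_le_div (by positivity)]
      calc y ^ 6 ≤ (16 * ℓ) ^ 6 := pow_le_pow_left₀ hy0.le (not_le.1 hlog).le 6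
        _ = _ := by ring
    refine const_le_rate (by positivity) (by positivity) hRy hR0.le h2 ?_
    rw [hM]
    have : 0 ≤ 4 * (1 + (L : ℝ)) ^ 2 * (8 * (L * a₂)) := by positivity
    linarith
  obtain ⟨s, hs, hsq, hsR, htail⟩ := exists_cap (P := P) hF hq hκ0 (by linarith) hy0 hny hlog
  refine (le_prob_forall_typical hF hV hlaw hind hN hn hTn hη hη1 htail).trans
    (measureReal_mono fun ω hω => ?_)
  obtain ⟨t, ht, hle⟩ := exists_gradMap_sq_le_of_typical hF hbm hb hsm (f := f) hq hs hsq hn hT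
    hδ hC hconv hr₁ hCδ hD (div_pos ha₁ hTsq) (fun t ht => (hα t ht).1)
    (fun t ht => (mul_le_mul_of_nonneg_left (hα t ht).2 L.2).trans hstep)
    (v := fun i => V i ω) hω
  refine ⟨t, ht, hle.trans ?_⟩
  have herr := sq_error_le (L := L) L.2 hc₁ hκ hκ0 hq hεD hδ₁ hδ₂ hs.1 hℓ2 hn (pow_pos hy0 6) hny
  have e : T * (a₁ / √(T : ℝ)) = a₁ * √(T : ℝ) := by
    field_simp
    rw [Real.sq_sqrt (Nat.cast_nonneg T)]
  rw [e]
  exact rate_le ha₁ (pow_pos hy0 6) hR0.le hℓ2 hκR hRy hsR hTy herr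
    (le_add_of_nonneg_right (by positivity))
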